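/- **Theorem 1.3 (Abstract random tensor estimate).** Let $k,d\ge 0$ be integers and let $A,B$ be finite index sets. Put $J=\{1,\dots,k\}$, regarded as disjoint from $A$ and $B$, which are also disjoint from each other. There is a constant $C=C(k,d,|A|,|B|)>0$ such that the following holds. Let $N\ge 2$ be an integer and let $h=h_{n_Jn_An_B}$ be a (real- or complex-valued) deterministic tensor, i.e. a function of $n_J\in(\mathbb Z^d)^J$, $n_A\in(\mathbb Z^d)^A$, $n_B\in(\mathbb Z^d)^B$, such that $|n_i|\le N$ for all $i\in J\sqcup A\sqcup B$ on the support of $h$, where $|\cdot|$ is the $\ell^1$ norm on $\mathbb Z^d$. Let $(g_n)_{n\in\mathbb Z^d}$ be independent standard complex Gaussians (the real and imaginary parts of each $g_n$ are independent centered real Gaussians of variance $1/2$), let $\iota_1,\dots,\iota_k\in\{\pm1\}$, and define $$G_{n_An_B}=\sum_{n_J\in(\mathbb Z^d)^k}h_{n_Jn_An_B}\,\mathcal L(g_{n_J}^{\iota_J}),\qquad \mathcal L(g_{n_J}^{\iota_J})=\prod_{n\in\mathbb Z^d}\mathcal L\big(\sigma(n),\mu(n),g_n\big).$$ Here $\sigma(n)=|\{j\in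 J:n_j=n\}|$, $\mu(n)=\sum_{j\in J,\,n_j=n}\iota_j$, and, with $m=\tfrac{\sigma-|\mu|}2$, $$\mathcal L(\sigma,\mu,z)=(-1)^{m}\,m!\;L^{|\mu|}_{m}(|z|^2)\,z^{\mu},$$ where $z^{\mu}:=\overline z^{\,|\mu|}$ if $\mu<0$, and $L^\alpha_m$ are the generalized Laguerre polynomials: $L_0^\alpha(x)=1$, $L_1^\alpha(x)=1+\alpha-x$, and $(m+1)L^\alpha_{m+1}(x)=(2m+1+\alpha-x)L^\alpha_m(x)-(m+\alpha)L^\alpha_{m-1}(x)$ for $m\ge1$. (Pairings, i.e. $n_i=n_j$ with $\iota_i+\iota_j=0$, are allowed in the support of $h$.) Then for all real $p\ge1$ $$\mathbb E\big[\|G\|^p_{n_A\to n_B}\big]^{1/p}\le C\,p^{k/2}(\log N)^{k/2}\max_{X\sqcup Y=J}\|h\|_{n_An_X\to n_Bn_Y}.$$ For a tensor $T=T_{n_I}$ with finite index set $I$ and a partition $X\sqcup Y=I$, $$\|T\|_{n_X\to n_Y}^2=\sup\Big\{\sum_{n_Y}\Big|\sum_{n_X}T_{n_I}v_{n_X}\Big|^2:\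 v:(\mathbb Z^d)^X\to\mathbb C,\ \sum_{n_X}|v_{n_X}|^2\le1\Big\},$$ i.e. $\|T\|_{n_X\to n_Y}$ is the operator norm of $T$ from $\ell^2_{n_X}$ to $\ell^2_{n_Y}$. -/

import Mathlib

open MeasureTheory ProbabilityTheory
open scoped ENNReal NNReal

/-- A tensor with finite index set `I`: a function of `n_I = (n_i)_{i ∈ I} ∈ (ℤ^d)^I`. -/
abbrev LatticeTensor (d : ℕ) (I : Type*) : Type _ := (I → Fin d → ℤ) → ℂ

open Classical in
/-- The index `n_I` obtained by putting together `n_X` and `n_Y`, where `Y = I \ X`. -/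
noncomputable def mergeIndex {d : ℕ} {I : Type*} (X : Set I)
    (x : X → Fin d → ℤ) (y : (Xᶜ : Set I) → Fin d → ℤ) : I → Fin d → ℤ :=
  fun i => if hi : i ∈ X then x ⟨i, hi⟩ else y ⟨i, hi⟩

/-- The tensor norm `‖h‖_{n_X → n_Y}` with `Y = I \ X`: the operator norm from `ℓ²_{n_X}` to
`ℓ²_{n_Y}` of the linear map whose kernel is `h`, as an extended nonnegative real. -/
noncomputable def tensorNorm {d : ℕ} {I : Type*} (h : LatticeTensor d I) (X : Set I) : ℝ≥0∞ :=
  (⨆ (v : (X → Fin d → ℤ) → ℂ) (_ : ∑' x, ‖v x‖ₑ ^ 2 ≤ 1),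
    ∑' y : (Xᶜ : Set I) → Fin d → ℤ, ‖∑' x, h (mergeIndex X x y) * v x‖ₑ ^ 2) ^ (1 / 2 : ℝ)

/-- The generalized Laguerre polynomial `L_m^α(x)`, by its three-term recurrence. -/
noncomputable def genLaguerre (α : ℝ) : ℕ → ℝ → ℝ
  | 0, _ => 1
  | 1, x => 1 + α - x
  | m + 2, x =>
      ((2 * (m + 1 : ℝ) + 1 + α - x) * genLaguerre α (m + 1) x
        - ((m + 1 : ℝ) + α) * genLaguerre α m x) / ((m + 1 : ℝ) + 1)

/-- `z ^ μ` for `μ ≥ 0` and `(conj z) ^ |μ|` for `μ < 0`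
(the convention `g^{+1} = g`, `g^{-1} = conj g`). -/
noncomputable def signedPow (z : ℂ) (μ : ℤ) : ℂ :=
  if 0 ≤ μ then z ^ μ.natAbs else (starRingEnd ℂ z) ^ μ.natAbs

/-- `𝓛(σ, μ, z) = (-1)^m m! L_m^{|μ|}(|z|²) z^μ` with `m = (σ - |μ|) / 2`. It is only used when
`|μ| ≤ σ` and `σ - |μ|` is even. -/
noncomputable def laguerreType (σ : ℕ) (μ : ℤ) (z : ℂ) : ℂ :=
  (((-1) ^ ((σ - μ.natAbs) / 2) * (((σ - μ.natAbs) / 2).factorial : ℝ)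
      * genLaguerre (μ.natAbs : ℝ) ((σ - μ.natAbs) / 2) (‖z‖ ^ 2) : ℝ) : ℂ)
    * signedPow z μ

/-- `σ_{n_J}(n)`, the number of `j` with `n_j = n`. -/
def indexCount {d k : ℕ} (nJ : Fin k → Fin d → ℤ) (n : Fin d → ℤ) : ℕ :=
  (Finset.univ.filter fun j => nJ j = n).card

/-- `μ_{n_J}(n)`, the sum of the signs `ι_j` over the `j` with `n_j = n`. -/
def signedCount {d k : ℕ} (ι : Fin k → ℤˣ) (nJ : Fin k → Fin d → ℤ) (n : Fin d → ℤ) : ℤ :=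
  ∑ j ∈ Finset.univ.filter (fun j => nJ j = n), (ι j : ℤ)

/-- The renormalized product `:∏_j g_{n_j}^{ι_j}: = ∏_n 𝓛(σ(n), μ(n), g_n)`. All factors but those
with `n ∈ {n_1, …, n_k}` are equal to `1`. -/
noncomputable def renormProd {d k : ℕ} (ι : Fin k → ℤˣ) (g : (Fin d → ℤ) → ℂ)
    (nJ : Fin k → Fin d → ℤ) : ℂ :=
  ∏ᶠ n : Fin d → ℤ, laguerreType (indexCount nJ n) (signedCount ι nJ n) (g n)

/-- The law of a standard complex Gaussian `g` (`E g = 0`, `E g² = 0`, `E |g|² = 1`): real and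
imaginary part are independent centered real Gaussians of variance `1 / 2`. -/
noncomputable def stdComplexGaussian : Measure ℂ :=
  ((gaussianReal 0 (1 / 2 : ℝ≥0)).prod (gaussianReal 0 (1 / 2 : ℝ≥0))).map
    Complex.measurableEquivRealProd.symm

/-- The tensor `G_{n_A n_B} = ∑_{n_J} h_{n_J n_A n_B} :∏_j g_{n_j}^{ι_j}:` at a realization `g` of
the Gaussians. The index set of `h` is the disjoint union of `J = Fin k`, `A` and `B`. -/
noncomputable def randomTensor {d k : ℕ} {A B : Type*} (h : LatticeTensor d (Fin k ⊕ (A ⊕ B)))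
    (ι : Fin k → ℤˣ) (g : (Fin d → ℤ) → ℂ) : LatticeTensor d (A ⊕ B) :=
  fun nAB => ∑' nJ : Fin k → Fin d → ℤ, h (Sum.elim nJ nAB) * renormProd ι g nJ

/-!
# Moments of random tensors built from Wick products of complex Gaussians

The estimate is proved by induction on the number `k` of random indices, one index at a time.
Restricting all indices to a finite lattice ball `T`, the random tensor becomes a chaos
`wickSum ι h z = ∑_n wick ι n z • h n` with matrix coefficients `h n` (columns `n_A`, rows `n_B`) in a
vector `z` of independent standard complex Gaussians, and tensor norms become `ℓ²` operator norms of
matrices (`enorm_le_tensorNorm`, `tensorNorm_le_enorm`). The Laguerre factor of a site with `a` signs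
`+1` and `b` signs `-1` is the complex Hermite polynomial `cHermite z (conj z) a b`
(`laguerreType_eq_cHermite`).

*Splitting off an index.* Let `w`, `s` be independent Gaussian vectors and `g₁ = (w + s) / √2`,
`g₂ = (s - w) / √2`, which are again independent Gaussian vectors. Averaging `g₁^{ι_1}` times a Wick
product of order `k` in `g₂` over `w` gives `2^{-(k+1)/2}` times the Wick product of order `k + 1` in
`s`; this is a site-wise consequence of the recurrences of the Hermite polynomials and of Gaussian
integration by parts (`integral_signConj_mul_wick`). By Jensen's inequality, the moments of the chaos
of order `k + 1` are therefore bounded by those of `∑_t g₁(t)^{ι_1} H_t(g₂)`, where the `H_t` are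
chaoses of order `k` independent of `g₁`.

*Noncommutative Khintchine inequality.* For fixed matrices `H_t`, the `p`-th moment of
`‖∑_t z_t H_t‖` is at most `(C (p + log D))^{p/2}` times the `p`-th power of the larger of the two
norms of `H` in which `t` is put together with the columns or with the rows, `D` being the dimension
(`lintegral_norm_gaussian_sum_le`). After Hermitian dilation this follows from the recursion
`E tr X^{2n+2} ≤ 2 (2n+1) K E tr X^{2n}` for the trace moments (`integral_frobSq_pow_succ_le`), which
is Gaussian integration by parts combined with an elementary eigenvalue inequality
(`re_trace_mixed_le`).

Each step thus costs a factor `(p log N)^{1/2}` and moves one random index to the columns or to the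
rows; after `k` steps the flattenings of `h` over all partitions of the random indices are left
(`exists_lintegral_wickSum_le`).
-/

/-! ### Standard complex Gaussian vectors -/

section

open scoped ComplexConjugate

instance : IsGaussian stdComplexGaussian := by
  have : stdComplexGaussian = ((gaussianReal 0 (1 / 2 : ℝ≥0)).prod
      (gaussianReal 0 (1 / 2 : ℝ≥0))).map Complex.equivRealProdCLM.symm := rfl
  rw [this]
  infer_instance

lemma stdComplexGaussian_eq_withDensity :
    stdComplexGaussian = volume.withDensity
      fun z : ℂ => ENNReal.ofReal (Real.pi⁻¹ * Real.exp (-‖z‖ ^ (2 : ℝ))) := by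
  have h2 : (1 / 2 : ℝ≥0) ≠ 0 := by norm_num
  rw [stdComplexGaussian, gaussianReal_of_var_ne_zero _ h2,
    prod_withDensity (measurable_gaussianPDF _ _) (measurable_gaussianPDF _ _),
    ← Measure.volume_eq_prod]
  ext s hs
  have hm := Complex.volume_preserving_equiv_real_prod.symm
  rw [Measure.map_apply (MeasurableEquiv.measurable _) hs,
    withDensity_apply _ (MeasurableEquiv.measurable _ hs), withDensity_apply _ hs,
    ← hm.setLIntegral_comp_preimage hs (by fun_prop)]
  refine lintegral_congr fun x => ?_
  rw [gaussianPDF, gaussianPDF, ← ENNReal.ofReal_mul (gaussianPDFReal_nonneg _ _ _)]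
  congr 1
  have hx : ‖Complex.measurableEquivRealProd.symm x‖ ^ (2 : ℝ) = x.1 ^ 2 + x.2 ^ 2 := by
    rw [Real.rpow_two, Complex.sq_norm, Complex.normSq_apply,
      Complex.measurableEquivRealProd_symm_apply]
    ring
  rw [hx, gaussianPDFReal, gaussianPDFReal]
  have h3 : (2 * Real.pi * ((1 / 2 : ℝ≥0) : ℝ)) = Real.pi := by push_cast; ring
  have h4 : (2 * ((1 / 2 : ℝ≥0) : ℝ)) = 1 := by push_cast; ring
  rw [h3, h4, mul_mul_mul_comm, ← Real.exp_add, ← mul_inv, Real.mul_self_sqrt Real.pi_pos.le]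
  congr 2
  ring

lemma integral_stdComplexGaussian (f : ℂ → ℂ) :
    ∫ z, f z ∂stdComplexGaussian
      = ∫ z : ℂ, (Real.pi⁻¹ * Real.exp (-‖z‖ ^ (2 : ℝ))) • f z := by
  rw [stdComplexGaussian_eq_withDensity,
    integral_withDensity_eq_integral_toReal_smul (by fun_prop) (by simp)]
  refine integral_congr_ae (.of_forall fun z => ?_)
  dsimp only
  rw [ENNReal.toReal_ofReal (by positivity)]

/-- Moments of a standard complex Gaussian: `E z ^ a * conj z ^ b` vanishes for `a ≠ b` by rotation
invariance, and is a Gamma integral in polar coordinates for `a = b`. -/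
lemma integral_pow_mul_conj_pow (a b : ℕ) :
    ∫ z, z ^ a * conj z ^ b ∂stdComplexGaussian = if a = b then (a.factorial : ℂ) else 0 := by
  rw [integral_stdComplexGaussian]
  split_ifs with hab
  · subst hab
    have h1 : ∀ z : ℂ, (Real.pi⁻¹ * Real.exp (-‖z‖ ^ (2 : ℝ))) • (z ^ a * conj z ^ a)
        = ((Real.pi⁻¹ * (‖z‖ ^ ((2 * a : ℕ) : ℝ) * Real.exp (-‖z‖ ^ (2 : ℝ))) : ℝ) : ℂ) := by
      intro z
      rw [← mul_pow, Complex.mul_conj, Complex.normSq_eq_norm_sq, Real.rpow_natCast, pow_mul,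
        Complex.real_smul]
      push_cast
      ring
    simp_rw [h1]
    rw [integral_complex_ofReal, integral_const_mul,
      Complex.integral_rpow_mul_exp_neg_rpow (by norm_num) (by
        have : (0 : ℝ) ≤ ((2 * a : ℕ) : ℝ) := Nat.cast_nonneg _
        linarith)]
    have h2 : (((2 * a : ℕ) : ℝ) + 2) / 2 = (a : ℝ) + 1 := by push_cast; ring
    rw [h2, Real.Gamma_nat_eq_factorial, mul_div_cancel_left₀ _ (by norm_num : (2 : ℝ) ≠ 0),
      inv_mul_cancel_left₀ Real.pi_ne_zero]
    simp
  · set I := ∫ z : ℂ, (Real.pi⁻¹ * Real.exp (-‖z‖ ^ (2 : ℝ))) • (z ^ a * conj z ^ b) with hI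
    have key : ∀ u : Circle, I = (u : ℂ) ^ a * conj (u : ℂ) ^ b * I := by
      intro u
      have h := (rotation u).measurePreserving.integral_comp
        (rotation u).toHomeomorph.measurableEmbedding
        (fun z : ℂ => (Real.pi⁻¹ * Real.exp (-‖z‖ ^ (2 : ℝ))) • (z ^ a * conj z ^ b))
      refine h.symm.trans ?_
      rw [hI, ← integral_const_mul]
      refine integral_congr_ae (.of_forall fun z => ?_)
      simp only [rotation_apply, norm_mul, Circle.norm_coe, one_mul, map_mul, mul_pow,
        Complex.real_smul]
      ring
    by_contra h0
    -- the rotation by the angle `π / (a - b)` would multiply the integral by `-1`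
    have hab' : (a : ℝ) - b ≠ 0 := sub_ne_zero.2 (by exact_mod_cast hab)
    have h2 : (Circle.exp (Real.pi / (a - b)) : ℂ) ^ a *
        conj (Circle.exp (Real.pi / (a - b)) : ℂ) ^ b = 1 := by
      apply mul_right_cancel₀ h0
      rw [one_mul, ← key]
    rw [← Circle.coe_inv_eq_conj, ← Circle.coe_pow, ← Circle.coe_pow, ← Circle.coe_mul,
      Circle.coe_eq_one, inv_pow, mul_inv_eq_one, ← Circle.exp_natCast_mul,
      ← Circle.exp_natCast_mul] at h2
    obtain ⟨m, hm⟩ := Circle.exp_eq_exp.mp h2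
    have h3 : Real.pi * (1 - 2 * m) = 0 := by
      have : ((a : ℝ) - b) * (Real.pi / (a - b)) = m * (2 * Real.pi) := by linarith
      rw [mul_div_cancel₀ _ hab'] at this
      linarith
    have h4 : (1 : ℝ) - 2 * m = 0 := (mul_eq_zero.1 h3).resolve_left Real.pi_ne_zero
    have h5 : (1 : ℤ) - 2 * m = 0 := by exact_mod_cast h4
    omega

lemma integrable_pow_mul_conj_pow (a b : ℕ) :
    Integrable (fun z : ℂ => z ^ a * conj z ^ b) stdComplexGaussian := by
  have h := (IsGaussian.memLp_id stdComplexGaussian ((a + b : ℕ) : ℝ≥0∞) (by simp)).integrable_norm_pow'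
  refine h.mono' (by fun_prop) (.of_forall fun z => ?_)
  simp [pow_add]

variable {T : Type*} [Fintype T]

/-- The law of a finite family of independent standard complex Gaussians. -/
noncomputable abbrev gaussianVec (T : Type*) [Fintype T] : Measure (T → ℂ) :=
  Measure.pi fun _ => stdComplexGaussian

instance : IsGaussian (gaussianVec T) := by
  have h : iIndepFun (fun (t : T) (z : T → ℂ) => z t) (gaussianVec T) :=
    iIndepFun_pi (X := fun _ => id) fun _ => aemeasurable_id
  have h1 := h.hasGaussianLaw fun t => ⟨by
    rw [(measurePreserving_eval (fun _ : T => stdComplexGaussian) t).map_eq]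
    infer_instance⟩
  have := h1.isGaussian_map
  rwa [Measure.map_id'] at this

lemma integral_id_gaussianVec : (gaussianVec T)[id] = 0 := by
  ext t
  have h := IsGaussian.integrable_id (μ := gaussianVec T)
  have h1 := (ContinuousLinearMap.proj (R := ℝ) (φ := fun _ : T => ℂ) t).integral_comp_comm h
  simp only [id_eq, ContinuousLinearMap.proj_apply] at h1 ⊢
  rw [← h1]
  have h2 := (measurePreserving_eval (fun _ : T => stdComplexGaussian) t).map_eq
  have h3 : ∫ z, z ∂((gaussianVec T).map (Function.eval t)) = ∫ z : T → ℂ, z t ∂gaussianVec T :=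
    integral_map (measurable_pi_apply t).aemeasurable (by fun_prop)
  rw [← h3, h2]
  simpa using integral_pow_mul_conj_pow 1 0

/-- Invariance of a pair of independent Gaussian vectors under rotation by `π / 4`. -/
lemma measurePreserving_rotate_gaussianVec :
    MeasurePreserving (fun x : (T → ℂ) × (T → ℂ) =>
      ((√2 / 2) • x.1 + (√2 / 2) • x.2, -(√2 / 2) • x.1 + (√2 / 2) • x.2))
      ((gaussianVec T).prod (gaussianVec T)) ((gaussianVec T).prod (gaussianVec T)) := by
  refine ⟨by fun_prop, ?_⟩
  have h := IsGaussian.map_rotation_eq_self (μ := gaussianVec T) integral_id_gaussianVec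
    (Real.pi / 4)
  convert h using 2
  ext x : 1
  simp [ContinuousLinearMap.rotation]

end

/-! ### Gaussian integration by parts for polynomials -/

section

open scoped ComplexConjugate

section Wick
open MvPolynomial

variable {T : Type*}

/-- Evaluation of a polynomial in the variables `z_t` (the left summand) and `conj z_t` (the right
summand). -/
noncomputable def evalConj (z : T → ℂ) : MvPolynomial (T ⊕ T) ℂ →+* ℂ :=
  eval (Sum.elim z fun t => conj (z t))

@[simp] lemma evalConj_X_inl (z : T → ℂ) (t : T) : evalConj z (X (Sum.inl t)) = z t := by
  simp [evalConj]

@[simp] lemma evalConj_X_inr (z : T → ℂ) (t : T) :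
    evalConj z (X (Sum.inr t)) = conj (z t) := by
  simp [evalConj]

@[simp] lemma evalConj_C (z : T → ℂ) (c : ℂ) : evalConj z (C c) = c := by
  simp [evalConj]

variable [Fintype T]

lemma evalConj_monomial (z : T → ℂ) (m : T ⊕ T →₀ ℕ) (c : ℂ) :
    evalConj z (monomial m c)
      = c * ∏ t, (z t ^ m (Sum.inl t) * conj (z t) ^ m (Sum.inr t)) := by
  rw [evalConj, eval_monomial, Finsupp.prod_fintype _ _ (by simp), Fintype.prod_sum_type,
    Finset.prod_mul_distrib]
  simp

lemma integral_evalConj_monomial (m : T ⊕ T →₀ ℕ) (c : ℂ) :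
    ∫ z, evalConj z (monomial m c) ∂gaussianVec T
      = c * ∏ t, if m (Sum.inl t) = m (Sum.inr t) then ((m (Sum.inl t)).factorial : ℂ) else 0 := by
  simp_rw [evalConj_monomial, ← integral_pow_mul_conj_pow]
  rw [integral_const_mul, integral_fintype_prod_eq_prod
    (f := fun t (w : ℂ) => w ^ m (Sum.inl t) * conj w ^ m (Sum.inr t))]

lemma integrable_evalConj (P : MvPolynomial (T ⊕ T) ℂ) :
    Integrable (fun z => evalConj z P) (gaussianVec T) := by
  induction P using MvPolynomial.induction_on' with
  | monomial m c =>
    simp_rw [evalConj_monomial]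
    exact (Integrable.fintype_prod fun t => integrable_pow_mul_conj_pow _ _).const_mul c
  | add p q hp hq =>
    simp_rw [map_add]
    exact hp.add hq

/-- Gaussian integration by parts for the monomials of one variable, the case of a factor `z`. -/
lemma moment_succ_left (a b : ℕ) :
    (if 1 + a = b then ((1 + a).factorial : ℂ) else 0)
      = b * if a = b - 1 then (a.factorial : ℂ) else 0 := by
  rcases b with _ | b
  · simp
  · by_cases h : a = b
    · simp [h, add_comm 1 b, Nat.factorial_succ]
    · simp [h, add_comm 1 a]

/-- Gaussian integration by parts for the monomials of one variable, the case of a factor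
`conj z`. -/
lemma moment_succ_right (a b : ℕ) :
    (if a = 1 + b then (a.factorial : ℂ) else 0)
      = a * if a - 1 = b then ((a - 1).factorial : ℂ) else 0 := by
  rcases a with _ | a
  · simp [add_comm 1 b]
  · by_cases h : a = b
    · simp [h, add_comm 1 b, Nat.factorial_succ]
    · simp [h, add_comm 1 b]

/-- Gaussian integration by parts: `E[z_t P] = E[∂P/∂(conj z_t)]`. -/
lemma integral_X_inl_mul (t : T) (P : MvPolynomial (T ⊕ T) ℂ) :
    ∫ z, evalConj z (X (Sum.inl t) * P) ∂gaussianVec T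
      = ∫ z, evalConj z (pderiv (Sum.inr t) P) ∂gaussianVec T := by
  classical
  induction P using MvPolynomial.induction_on' with
  | monomial m c =>
    rw [pderiv_monomial, X, monomial_mul, integral_evalConj_monomial, integral_evalConj_monomial,
      one_mul, mul_assoc, ← Finset.mul_prod_erase _ _ (Finset.mem_univ t),
      ← Finset.mul_prod_erase (a := t) _ _ (Finset.mem_univ t), ← mul_assoc (m _ : ℂ)]
    congr 2
    · simpa using moment_succ_left (m (Sum.inl t)) (m (Sum.inr t))
    · refine Finset.prod_congr rfl fun s hs => ?_
      have hst : t ≠ s := (Finset.ne_of_mem_erase hs).symm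
      simp [hst]
  | add p q hp hq =>
    simp only [mul_add, map_add] at *
    rw [integral_add (integrable_evalConj _) (integrable_evalConj _),
      integral_add (integrable_evalConj _) (integrable_evalConj _), hp, hq]

/-- Gaussian integration by parts: `E[(conj z_t) P] = E[∂P/∂z_t]`. -/
lemma integral_X_inr_mul (t : T) (P : MvPolynomial (T ⊕ T) ℂ) :
    ∫ z, evalConj z (X (Sum.inr t) * P) ∂gaussianVec T
      = ∫ z, evalConj z (pderiv (Sum.inl t) P) ∂gaussianVec T := by
  classical
  induction P using MvPolynomial.induction_on' with
  | monomial m c =>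
    rw [pderiv_monomial, X, monomial_mul, integral_evalConj_monomial, integral_evalConj_monomial,
      one_mul, mul_assoc, ← Finset.mul_prod_erase _ _ (Finset.mem_univ t),
      ← Finset.mul_prod_erase (a := t) _ _ (Finset.mem_univ t), ← mul_assoc (m _ : ℂ)]
    congr 2
    · simpa using moment_succ_right (m (Sum.inl t)) (m (Sum.inr t))
    · refine Finset.prod_congr rfl fun s hs => ?_
      have hst : t ≠ s := (Finset.ne_of_mem_erase hs).symm
      simp [hst]
  | add p q hp hq =>
    simp only [mul_add, map_add] at *
    rw [integral_add (integrable_evalConj _) (integrable_evalConj _),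
      integral_add (integrable_evalConj _) (integrable_evalConj _), hp, hq]

end Wick

end

/-! ### Trace moments of Gaussian matrices -/

section

open scoped ComplexConjugate Matrix

section MatrixMoments
open MvPolynomial

variable {T D D' : Type*} [Fintype D] [Fintype D']

/-- The square of the Frobenius norm of a matrix. -/
noncomputable def frobSq (M : Matrix D D' ℂ) : ℝ := ∑ i, ∑ j, ‖M i j‖ ^ 2

lemma trace_conjTranspose_mul_self (M : Matrix D D' ℂ) :
    (Mᴴ * M).trace = (frobSq M : ℂ) := by
  simp only [Matrix.trace, Matrix.diag, Matrix.mul_apply, Matrix.conjTranspose_apply, frobSq]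
  rw [Finset.sum_comm]
  push_cast
  refine Finset.sum_congr rfl fun i _ => Finset.sum_congr rfl fun j _ => ?_
  rw [← Complex.ofReal_pow, ← Complex.normSq_eq_norm_sq, ← Complex.mul_conj, mul_comm]
  rfl

lemma frobSq_conj_unitary [DecidableEq D] (U : Matrix.unitaryGroup D ℂ) (M : Matrix D D ℂ) :
    frobSq (star (U : Matrix D D ℂ) * M * (U : Matrix D D ℂ)) = frobSq M := by
  have hU : (U : Matrix D D ℂ) * star (U : Matrix D D ℂ) = 1 := Unitary.coe_mul_star_self U
  have h : ((star (U : Matrix D D ℂ) * M * (U : Matrix D D ℂ))ᴴ *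
      (star (U : Matrix D D ℂ) * M * (U : Matrix D D ℂ))).trace
      = (Mᴴ * M).trace := by
    rw [← Matrix.star_eq_conjTranspose, star_mul, star_mul, star_star]
    calc _ = (star (U : Matrix D D ℂ) * (star M * ((U : Matrix D D ℂ) * star (U : Matrix D D ℂ))
          * M * (U : Matrix D D ℂ))).trace := by simp only [mul_assoc]
      _ = _ := by
        rw [hU, mul_one, Matrix.trace_mul_comm, mul_assoc, hU, mul_one]
        rfl
  rw [trace_conjTranspose_mul_self, trace_conjTranspose_mul_self] at h
  exact_mod_cast h

/-- For a Hermitian `X` and `q + r = 2 n`, the mixed trace `tr (A X^q Aᴴ X^r)` is bounded by the two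
unmixed ones. In an eigenbasis of `X` this is `x ^ q * y ^ r ≤ x ^ (2 * n) + y ^ (2 * n)` for the
eigenvalues. -/
lemma re_trace_mixed_le [DecidableEq D] {X : Matrix D D ℂ} (hX : X.IsHermitian)
    (A : Matrix D D ℂ) {q r n : ℕ} (hqr : q + r = 2 * n) :
    (A * X ^ q * Aᴴ * X ^ r).trace.re ≤ frobSq (A * X ^ n) + frobSq (Aᴴ * X ^ n) := by
  set U := hX.eigenvectorUnitary
  set l := hX.eigenvalues
  set Λ : Matrix D D ℂ := Matrix.diagonal (fun i => (l i : ℂ)) with hΛ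
  have hU : (U : Matrix D D ℂ) * star (U : Matrix D D ℂ) = 1 := Unitary.coe_mul_star_self U
  have hU' : star (U : Matrix D D ℂ) * (U : Matrix D D ℂ) = 1 := Unitary.coe_star_mul_self U
  have hspec : ∀ m : ℕ, X ^ m = U * Λ ^ m * star (U : Matrix D D ℂ) := by
    intro m
    induction m with
    | zero => simp [hU]
    | succ m ih =>
      have h1 : X = U * Λ * star (U : Matrix D D ℂ) := by
        conv_lhs => rw [hX.spectral_theorem]
        simp [Unitary.conjStarAlgAut_apply, hΛ, U, l, Function.comp_def]
      rw [pow_succ, ih]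
      conv_lhs => rw [h1]
      calc _ = U * Λ ^ m * (star (U : Matrix D D ℂ) * U) * Λ * star (U : Matrix D D ℂ) := by
            simp only [mul_assoc]
        _ = _ := by rw [hU', mul_one, pow_succ]; simp only [mul_assoc]
  have hpow : ∀ m : ℕ, Λ ^ m = Matrix.diagonal (fun i => (l i : ℂ) ^ m) := fun m => by
    rw [hΛ, Matrix.diagonal_pow]; rfl
  set B : Matrix D D ℂ := star (U : Matrix D D ℂ) * A * U with hB
  have hBs : Bᴴ = star (U : Matrix D D ℂ) * Aᴴ * U := by
    rw [hB, ← Matrix.star_eq_conjTranspose, star_mul, star_mul, star_star, mul_assoc]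
    rfl
  have e1 : (A * X ^ q * Aᴴ * X ^ r).trace = (B * Λ ^ q * Bᴴ * Λ ^ r).trace := by
    rw [hspec, hspec, hBs, hB]
    calc _ = ((A * U * Λ ^ q * star (U : Matrix D D ℂ) * Aᴴ * U * Λ ^ r)
          * star (U : Matrix D D ℂ)).trace := by simp only [mul_assoc]
      _ = _ := by rw [Matrix.trace_mul_comm]; simp only [mul_assoc]
  have hsq : ∀ x : ℝ, (|x| ^ n) ^ 2 = (x ^ n) ^ 2 := fun x => by rw [← abs_pow, sq_abs]
  have e2 : frobSq (A * X ^ n) = ∑ i, ∑ j, ‖B i j‖ ^ 2 * l j ^ (2 * n) := by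
    have : star (U : Matrix D D ℂ) * (A * X ^ n) * U = B * Λ ^ n := by
      rw [hspec, hB]
      simp only [mul_assoc]
      rw [hU', mul_one]
    rw [← frobSq_conj_unitary U, this, hpow]
    simp [frobSq, mul_pow, pow_mul', hsq]
  have e3 : frobSq (Aᴴ * X ^ n) = ∑ i, ∑ j, ‖B i j‖ ^ 2 * l i ^ (2 * n) := by
    have : star (U : Matrix D D ℂ) * (Aᴴ * X ^ n) * U = Bᴴ * Λ ^ n := by
      rw [hspec, hBs]
      simp only [mul_assoc]
      rw [hU', mul_one]
    rw [← frobSq_conj_unitary U, this, hpow, frobSq, Finset.sum_comm]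
    simp [mul_pow, pow_mul', hsq]
  have e4 : (B * Λ ^ q * Bᴴ * Λ ^ r).trace
      = ((∑ i, ∑ j, ‖B i j‖ ^ 2 * (l j ^ q * l i ^ r) : ℝ) : ℂ) := by
    rw [hpow, hpow, Matrix.trace]
    push_cast
    refine Finset.sum_congr rfl fun i _ => ?_
    rw [Matrix.diag, Matrix.mul_diagonal, Matrix.mul_apply, Finset.sum_mul]
    refine Finset.sum_congr rfl fun j _ => ?_
    rw [Matrix.mul_diagonal, Matrix.conjTranspose_apply, ← Complex.ofReal_pow ‖_‖,
      ← Complex.normSq_eq_norm_sq, ← Complex.mul_conj]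
    simp only [RCLike.star_def]
    ring
  rw [e1, e4, Complex.ofReal_re, e2, e3, ← Finset.sum_add_distrib]
  refine Finset.sum_le_sum fun i _ => ?_
  rw [← Finset.sum_add_distrib]
  refine Finset.sum_le_sum fun j _ => ?_
  rw [← mul_add]
  refine mul_le_mul_of_nonneg_left ?_ (by positivity)
  have habs : ∀ x : ℝ, x ^ (2 * n) = |x| ^ (2 * n) := fun x => by
    rw [pow_mul, pow_mul, sq_abs]
  rw [habs (l j), habs (l i)]
  refine (le_abs_self _).trans ?_
  rw [abs_mul, abs_pow, abs_pow]
  rcases le_total |l j| |l i| with h | h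
  · calc |l j| ^ q * |l i| ^ r ≤ |l i| ^ q * |l i| ^ r := by gcongr
      _ = |l i| ^ (2 * n) := by rw [← pow_add, hqr]
      _ ≤ _ := by linarith [pow_nonneg (abs_nonneg (l j)) (2 * n)]
  · calc |l j| ^ q * |l i| ^ r ≤ |l j| ^ q * |l j| ^ r := by gcongr
      _ = |l j| ^ (2 * n) := by rw [← pow_add, hqr]
      _ ≤ _ := by linarith [pow_nonneg (abs_nonneg (l i)) (2 * n)]

/-- The Leibniz rule for a derivation acting entrywise on a product of matrices. -/
lemma map_derivation_mul {R₀ R : Type*} [CommRing R₀] [CommRing R]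
    [Algebra R₀ R] (δ : Derivation R₀ R R) (M N : Matrix D D R) :
    (M * N).map δ = M.map δ * N + M * N.map δ := by
  ext i j
  simp only [Matrix.map_apply, Matrix.mul_apply, Matrix.add_apply, map_sum, Derivation.leibniz,
    ← Finset.sum_add_distrib, smul_eq_mul]
  exact Finset.sum_congr rfl fun k _ => by ring

lemma map_derivation_pow [DecidableEq D] {R₀ R : Type*} [CommRing R₀] [CommRing R]
    [Algebra R₀ R] (δ : Derivation R₀ R R)
    (M : Matrix D D R) (n : ℕ) :
    (M ^ n).map δ = ∑ q ∈ Finset.range n, M ^ q * M.map δ * M ^ (n - 1 - q) := by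
  induction n with
  | zero =>
    ext i j
    rcases eq_or_ne i j with h | h
    · simp [h]
    · simp [h]
  | succ n ih =>
    rw [pow_succ, map_derivation_mul, ih, Finset.sum_range_succ, Finset.sum_mul]
    congr 1
    · refine Finset.sum_congr rfl fun q hq => ?_
      have : n + 1 - 1 - q = (n - 1 - q) + 1 := by have := Finset.mem_range.1 hq; omega
      rw [this, pow_succ, mul_assoc]
    · simp

end MatrixMoments

section GaussianMatrix
open MvPolynomial

variable {T D : Type*} [Fintype T]

/-- The Hermitian Gaussian matrix `∑_t (z_t A_t + conj z_t A_tᴴ)`. -/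
noncomputable def gaussMat (A : T → Matrix D D ℂ) (z : T → ℂ) : Matrix D D ℂ :=
  ∑ t, (z t • A t + conj (z t) • (A t)ᴴ)

/-- The matrix `gaussMat A` with polynomial entries, before evaluation. -/
noncomputable def gaussMatPoly (A : T → Matrix D D ℂ) : Matrix D D (MvPolynomial (T ⊕ T) ℂ) :=
  ∑ t, ((X (Sum.inl t) : MvPolynomial (T ⊕ T) ℂ) • (A t).map C
    + (X (Sum.inr t) : MvPolynomial (T ⊕ T) ℂ) • ((A t)ᴴ).map C)

lemma isHermitian_gaussMat (A : T → Matrix D D ℂ) (z : T → ℂ) : (gaussMat A z).IsHermitian := by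
  rw [Matrix.IsHermitian, gaussMat, Matrix.conjTranspose_sum]
  refine Finset.sum_congr rfl fun t _ => ?_
  simp [add_comm]

lemma pderiv_inr_gaussMatPoly (A : T → Matrix D D ℂ) (t : T) :
    (gaussMatPoly A).map (pderiv (Sum.inr t)) = ((A t)ᴴ).map C := by
  classical
  ext1 i j
  simp [gaussMatPoly, Matrix.sum_apply, Pi.single_apply]

lemma pderiv_inl_gaussMatPoly (A : T → Matrix D D ℂ) (t : T) :
    (gaussMatPoly A).map (pderiv (Sum.inl t)) = (A t).map C := by
  classical
  ext1 i j
  simp [gaussMatPoly, Matrix.sum_apply, Pi.single_apply]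

variable [Fintype D] [DecidableEq D]

lemma mapMatrix_gaussMatPoly (A : T → Matrix D D ℂ) (z : T → ℂ) :
    (evalConj z).mapMatrix (gaussMatPoly A) = gaussMat A z := by
  ext i j
  simp [gaussMatPoly, gaussMat, Matrix.sum_apply]

lemma evalConj_trace {T : Type*} (z : T → ℂ) (M : Matrix D D (MvPolynomial (T ⊕ T) ℂ)) :
    evalConj z M.trace = ((evalConj z).mapMatrix M).trace := by
  simp [Matrix.trace]

lemma evalConj_trace_mul_pow (A : T → Matrix D D ℂ) (B : Matrix D D ℂ) (m : ℕ) (z : T → ℂ) :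
    evalConj z (B.map C * gaussMatPoly A ^ m).trace = (B * gaussMat A z ^ m).trace := by
  have hB : (evalConj z).mapMatrix (B.map C) = B := by ext i j; simp
  rw [evalConj_trace, map_mul, map_pow, mapMatrix_gaussMatPoly, hB]

lemma evalConj_pderiv_trace_mul_pow (A : T → Matrix D D ℂ) (B B' : Matrix D D ℂ) (m : ℕ)
    (i : T ⊕ T) (hB' : (gaussMatPoly A).map (pderiv i) = B'.map C) (z : T → ℂ) :
    evalConj z (pderiv i (B.map C * gaussMatPoly A ^ m).trace)
      = ∑ q ∈ Finset.range m, (B * gaussMat A z ^ q * B' * gaussMat A z ^ (m - 1 - q)).trace := by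
  have h1 : pderiv i (B.map C * gaussMatPoly A ^ m).trace
      = (B.map C * (gaussMatPoly A ^ m).map (pderiv i)).trace := by
    simp only [Matrix.trace, Matrix.diag, Matrix.mul_apply, Matrix.map_apply, map_sum,
      pderiv_C_mul]
  have hC : ∀ B : Matrix D D ℂ, (evalConj z).mapMatrix (B.map C) = B := fun B => by
    ext i j; simp
  rw [h1, map_derivation_pow, hB', evalConj_trace, map_mul, map_sum,
    hC, Finset.mul_sum, Matrix.trace_sum]
  simp only [map_mul, map_pow, mapMatrix_gaussMatPoly, hC, mul_assoc]

lemma integrable_trace_pow (A : T → Matrix D D ℂ) (m : ℕ) :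
    Integrable (fun z => (gaussMat A z ^ m).trace) (gaussianVec T) := by
  have := integrable_evalConj (T := T) ((1 : Matrix D D ℂ).map C * gaussMatPoly A ^ m).trace
  simpa [evalConj_trace_mul_pow] using this

/-- Integration by parts in `E tr X ^ (m + 1)`, applied to the first factor `X = gaussMat A z`: the
derivatives of the other `m` factors appear. -/
lemma integral_trace_pow_succ (A : T → Matrix D D ℂ) (m : ℕ) :
    Integrable (fun z => ∑ t, ∑ q ∈ Finset.range m,
          ((A t * gaussMat A z ^ q * (A t)ᴴ * gaussMat A z ^ (m - 1 - q)).trace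
          + ((A t)ᴴ * gaussMat A z ^ q * A t * gaussMat A z ^ (m - 1 - q)).trace))
        (gaussianVec T) ∧
    ∫ z, (gaussMat A z ^ (m + 1)).trace ∂gaussianVec T
      = ∫ z, ∑ t, ∑ q ∈ Finset.range m,
          ((A t * gaussMat A z ^ q * (A t)ᴴ * gaussMat A z ^ (m - 1 - q)).trace
          + ((A t)ᴴ * gaussMat A z ^ q * A t * gaussMat A z ^ (m - 1 - q)).trace)
        ∂gaussianVec T := by
  have h1 : ∀ z, (gaussMat A z ^ (m + 1)).trace
      = ∑ t, (evalConj z (X (Sum.inl t) * ((A t).map C * gaussMatPoly A ^ m).trace)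
        + evalConj z (X (Sum.inr t) * (((A t)ᴴ).map C * gaussMatPoly A ^ m).trace)) := by
    intro z
    simp only [map_mul, evalConj_trace_mul_pow, evalConj_X_inl, evalConj_X_inr]
    rw [pow_succ']
    conv_lhs => rw [gaussMat, Finset.sum_mul, Matrix.trace_sum]
    refine Finset.sum_congr rfl fun t _ => ?_
    rw [add_mul, Matrix.trace_add, smul_mul_assoc, smul_mul_assoc, Matrix.trace_smul,
      Matrix.trace_smul, smul_eq_mul, smul_eq_mul]
    rfl
  have h2 : ∀ z, (∑ t, ∑ q ∈ Finset.range m,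
          ((A t * gaussMat A z ^ q * (A t)ᴴ * gaussMat A z ^ (m - 1 - q)).trace
          + ((A t)ᴴ * gaussMat A z ^ q * A t * gaussMat A z ^ (m - 1 - q)).trace))
      = ∑ t, (evalConj z (pderiv (Sum.inr t) ((A t).map C * gaussMatPoly A ^ m).trace)
        + evalConj z (pderiv (Sum.inl t) (((A t)ᴴ).map C * gaussMatPoly A ^ m).trace)) := by
    intro z
    refine Finset.sum_congr rfl fun t _ => ?_
    rw [evalConj_pderiv_trace_mul_pow A _ _ m _ (pderiv_inr_gaussMatPoly A t),
      evalConj_pderiv_trace_mul_pow A _ _ m _ (pderiv_inl_gaussMatPoly A t),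
      Finset.sum_add_distrib]
  simp only [h1, h2]
  refine ⟨integrable_finsetSum _ fun t _ =>
    (integrable_evalConj _).add (integrable_evalConj _), ?_⟩
  rw [integral_finsetSum _ fun t _ => by
      exact (integrable_evalConj _).add (integrable_evalConj _),
    integral_finsetSum _ fun t _ => by
      exact (integrable_evalConj _).add (integrable_evalConj _)]
  refine Finset.sum_congr rfl fun t _ => ?_
  rw [integral_add (integrable_evalConj _) (integrable_evalConj _),
    integral_add (integrable_evalConj _) (integrable_evalConj _), integral_X_inl_mul,
    integral_X_inr_mul]

lemma trace_pow_two_mul {X : Matrix D D ℂ} (hX : X.IsHermitian) (n : ℕ) :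
    (X ^ (2 * n)).trace = (frobSq (X ^ n) : ℂ) := by
  rw [← trace_conjTranspose_mul_self, Matrix.conjTranspose_pow, hX.eq, two_mul, pow_add]

/-- The recursion for the trace moments of a Gaussian matrix, `K` being a bound for the matrix
variance `∑_t (A_tᴴ A_t + A_t A_tᴴ)`. -/
lemma integral_frobSq_pow_succ_le (A : T → Matrix D D ℂ) {K : ℝ}
    (hK : ∀ v : D → ℂ, ∑ t, (∑ i, ‖(A t).mulVec v i‖ ^ 2 + ∑ i, ‖((A t)ᴴ).mulVec v i‖ ^ 2)
      ≤ K * ∑ i, ‖v i‖ ^ 2) (n : ℕ) :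
    ∫ z, frobSq (gaussMat A z ^ (n + 1)) ∂gaussianVec T
      ≤ (2 * (2 * n + 1) * K) * ∫ z, frobSq (gaussMat A z ^ n) ∂gaussianVec T := by
  have hfrob : ∀ z n, frobSq (gaussMat A z ^ n) = ((gaussMat A z ^ (2 * n)).trace).re := by
    intro z n
    rw [trace_pow_two_mul (isHermitian_gaussMat A z), Complex.ofReal_re]
  have hint : ∀ n, Integrable (fun z => frobSq (gaussMat A z ^ n)) (gaussianVec T) := by
    intro n
    simp_rw [hfrob]
    exact (integrable_trace_pow A (2 * n)).re
  have h1 : ∫ z, frobSq (gaussMat A z ^ (n + 1)) ∂gaussianVec T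
      = (∫ z, (gaussMat A z ^ (2 * n + 1 + 1)).trace ∂gaussianVec T).re := by
    simp_rw [hfrob]
    exact integral_re (integrable_trace_pow A (2 * (n + 1)))
  have hV : ∀ z, ∑ t, (frobSq (A t * gaussMat A z ^ n) + frobSq ((A t)ᴴ * gaussMat A z ^ n))
      ≤ K * frobSq (gaussMat A z ^ n) := by
    intro z
    have h := fun j => hK (fun i => (gaussMat A z ^ n) i j)
    have h' := Finset.sum_le_sum fun j (_ : j ∈ Finset.univ) => h j
    rw [← Finset.mul_sum] at h'
    refine (le_of_eq ?_).trans (h'.trans (le_of_eq ?_))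
    · rw [Finset.sum_comm]
      refine Finset.sum_congr rfl fun t _ => ?_
      rw [Finset.sum_add_distrib, frobSq, frobSq, Finset.sum_comm,
        Finset.sum_comm (f := fun i j => ‖((A t)ᴴ * gaussMat A z ^ n) i j‖ ^ 2)]
      rfl
    · rw [frobSq, Finset.sum_comm]
  obtain ⟨hi, he⟩ := integral_trace_pow_succ A (2 * n + 1)
  rw [h1, he, ← integral_const_mul, ← RCLike.re_eq_complex_re, ← integral_re hi]
  refine integral_mono hi.re ((hint n).const_mul _) fun z => ?_
  simp only [RCLike.re_eq_complex_re, Complex.re_sum, Complex.add_re]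
  have hX := isHermitian_gaussMat A z
  calc _ ≤ ∑ t, ∑ _q ∈ Finset.range (2 * n + 1),
        2 * (frobSq (A t * gaussMat A z ^ n) + frobSq ((A t)ᴴ * gaussMat A z ^ n)) := by
        refine Finset.sum_le_sum fun t _ => Finset.sum_le_sum fun q hq => ?_
        have hq' : q + (2 * n + 1 - 1 - q) = 2 * n := by
          have := Finset.mem_range.1 hq
          omega
        have a1 := re_trace_mixed_le hX (A t) hq'
        have a2 := re_trace_mixed_le hX ((A t)ᴴ) hq'
        rw [Matrix.conjTranspose_conjTranspose] at a2
        linarith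
    _ = 2 * (2 * n + 1) * ∑ t, (frobSq (A t * gaussMat A z ^ n)
          + frobSq ((A t)ᴴ * gaussMat A z ^ n)) := by
        simp only [Finset.sum_const, Finset.card_range, nsmul_eq_mul, ← Finset.mul_sum]
        push_cast
        ring
    _ ≤ 2 * (2 * n + 1) * (K * frobSq (gaussMat A z ^ n)) :=
        mul_le_mul_of_nonneg_left (hV z) (by positivity)
    _ = _ := by ring

lemma integral_frobSq_pow_le (A : T → Matrix D D ℂ) {K : ℝ} (hK0 : 0 ≤ K)
    (hK : ∀ v : D → ℂ, ∑ t, (∑ i, ‖(A t).mulVec v i‖ ^ 2 + ∑ i, ‖((A t)ᴴ).mulVec v i‖ ^ 2)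
      ≤ K * ∑ i, ‖v i‖ ^ 2) (n : ℕ) :
    ∫ z, frobSq (gaussMat A z ^ n) ∂gaussianVec T ≤ (4 * n * K) ^ n * Fintype.card D := by
  have h : ∀ m ≤ n, ∫ z, frobSq (gaussMat A z ^ m) ∂gaussianVec T
      ≤ (4 * n * K) ^ m * Fintype.card D := by
    intro m
    induction m with
    | zero =>
      intro _
      have : frobSq (1 : Matrix D D ℂ) = Fintype.card D := by
        have := trace_conjTranspose_mul_self (1 : Matrix D D ℂ)
        rw [Matrix.conjTranspose_one, mul_one, Matrix.trace_one] at this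
        exact_mod_cast this.symm
      simp [this]
    | succ m ih =>
      intro hm
      have hm' : (m : ℝ) + 1 ≤ n := by exact_mod_cast hm
      refine (integral_frobSq_pow_succ_le A hK m).trans ?_
      calc 2 * (2 * m + 1) * K * ∫ z, frobSq (gaussMat A z ^ m) ∂gaussianVec T
          ≤ 4 * n * K * ((4 * n * K) ^ m * Fintype.card D) := by
            refine mul_le_mul ?_ (ih (by omega)) ?_ (by positivity)
            · exact mul_le_mul_of_nonneg_right (by linarith) hK0
            · exact integral_nonneg fun z => Finset.sum_nonneg fun i _ =>
                Finset.sum_nonneg fun j _ => by positivity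
        _ = _ := by ring
  exact h n le_rfl

end GaussianMatrix

end

/-! ### The noncommutative Khintchine inequality -/

section

open scoped ComplexConjugate Matrix Matrix.Norms.L2Operator

section OperatorNorm

variable {R S : Type*} [Fintype R] [Fintype S]

lemma sum_norm_mulVec_sq_le [DecidableEq R] (M : Matrix S R ℂ) (v : R → ℂ) :
    ∑ i, ‖M.mulVec v i‖ ^ 2 ≤ ‖M‖ ^ 2 * ∑ j, ‖v j‖ ^ 2 := by
  have h := Matrix.l2_opNorm_mulVec M (WithLp.toLp 2 v)
  have h2 := pow_le_pow_left₀ (norm_nonneg _) h 2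
  rw [mul_pow, EuclideanSpace.norm_sq_eq, EuclideanSpace.norm_sq_eq] at h2
  exact h2

lemma l2_opNorm_le_of_forall [DecidableEq R] (M : Matrix S R ℂ) {K : ℝ} (hK : 0 ≤ K)
    (h : ∀ v : R → ℂ, ∑ i, ‖M.mulVec v i‖ ^ 2 ≤ K ^ 2 * ∑ j, ‖v j‖ ^ 2) : ‖M‖ ≤ K := by
  rw [Matrix.l2_opNorm_def]
  refine ContinuousLinearMap.opNorm_le_bound _ hK fun v => ?_
  refine le_of_sq_le_sq ?_ (by positivity)
  rw [mul_pow, EuclideanSpace.norm_sq_eq, EuclideanSpace.norm_sq_eq]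
  exact h _

lemma l2_opNorm_submatrix_le [DecidableEq R] {R' S' : Type*} [Fintype R'] [Fintype S']
    [DecidableEq R'] (M : Matrix S R ℂ) {e : S' → S} {f : R' → R} (he : e.Injective)
    (hf : f.Injective) : ‖M.submatrix e f‖ ≤ ‖M‖ := by
  refine l2_opNorm_le_of_forall _ (norm_nonneg _) fun v => ?_
  set w : R → ℂ := Function.extend f v 0
  have hw : ∀ g : R → ℂ → ℂ, (∀ r, g r 0 = 0) → ∑ r, g r (w r) = ∑ r', g (f r') (v r') := by
    intro g hg
    rw [← Finset.sum_subset (Finset.subset_univ (Finset.univ.map ⟨f, hf⟩)), Finset.sum_map]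
    · refine Finset.sum_congr rfl fun r' _ => ?_
      simp [w, hf.extend_apply]
    · intro r _ hr
      have : ¬ ∃ r', f r' = r := by simpa using hr
      simp [w, Function.extend_apply' _ _ _ this, hg]
  have h1 : ∀ i, (M.submatrix e f).mulVec v i = M.mulVec w (e i) := fun i =>
    (hw (fun r x => M (e i) r * x) (by simp)).symm
  have h2 : ∑ j, ‖v j‖ ^ 2 = ∑ j, ‖w j‖ ^ 2 := by
    have := (hw (fun r x => ((‖x‖ ^ 2 : ℝ) : ℂ)) (by simp)).symm
    exact_mod_cast this
  simp_rw [h1, h2]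
  refine le_trans ?_ (sum_norm_mulVec_sq_le M w)
  refine (Finset.sum_map Finset.univ ⟨e, he⟩ fun i => ‖M.mulVec w i‖ ^ 2).symm.trans_le ?_
  exact Finset.sum_le_sum_of_subset_of_nonneg (Finset.subset_univ _) fun _ _ _ => by positivity

lemma l2_opNorm_sq_le_frobSq [DecidableEq R] (M : Matrix S R ℂ) : ‖M‖ ^ 2 ≤ frobSq M := by
  have h0 : 0 ≤ frobSq M := Finset.sum_nonneg fun i _ => Finset.sum_nonneg fun j _ => by positivity
  rw [← Real.le_sqrt (norm_nonneg _) h0]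
  refine l2_opNorm_le_of_forall _ (Real.sqrt_nonneg _) fun v => ?_
  rw [Real.sq_sqrt h0, frobSq, Finset.sum_mul]
  refine Finset.sum_le_sum fun i _ => ?_
  calc ‖M.mulVec v i‖ ^ 2 ≤ (∑ j, ‖M i j‖ * ‖v j‖) ^ 2 := by
        refine pow_le_pow_left₀ (norm_nonneg _) ?_ 2
        refine (norm_sum_le _ _).trans (le_of_eq ?_)
        exact Finset.sum_congr rfl fun j _ => norm_mul _ _
    _ ≤ _ := Finset.sum_mul_sq_le_sq_mul_sq _ _ _

/-- The exponent is a power of two because `‖X ^ q‖ = ‖X‖ ^ q` is available for such `q` from the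
C⋆-identity. -/
lemma l2_opNorm_pow_le_frobSq [DecidableEq R] {X : Matrix R R ℂ} (hX : X.IsHermitian) (m : ℕ) :
    ‖X‖ ^ (2 * 2 ^ m) ≤ frobSq (X ^ 2 ^ m) := by
  have h : ‖X ^ 2 ^ m‖ = ‖X‖ ^ 2 ^ m := congrArg NNReal.toReal (IsSelfAdjoint.nnnorm_pow_two_pow hX m)
  rw [mul_comm, pow_mul, ← h]
  exact l2_opNorm_sq_le_frobSq _

end OperatorNorm

section Khintchine

lemma continuous_gaussMat {T D : Type*} [Fintype T] [Fintype D] [DecidableEq D]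
    (A : T → Matrix D D ℂ) : Continuous (gaussMat A) := by
  unfold gaussMat
  fun_prop

variable {T D R S : Type*} [Fintype T] [Fintype D] [DecidableEq D] [Fintype R] [Fintype S]
  [DecidableEq R] [DecidableEq S]

/-- The trace moment of order `2 * 2 ^ m` controls the norm; the dimension enters as
`card D ^ (1 / 2 ^ m) ≤ e`. -/
lemma lintegral_norm_gaussMat_le (A : T → Matrix D D ℂ) {κ : ℝ} (hκ : 0 ≤ κ)
    (hK : ∀ v : D → ℂ, ∑ t, (∑ i, ‖(A t).mulVec v i‖ ^ 2 + ∑ i, ‖((A t)ᴴ).mulVec v i‖ ^ 2)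
      ≤ κ ^ 2 * ∑ i, ‖v i‖ ^ 2) {m : ℕ} {p : ℝ} (hp : 1 ≤ p) (hpm : p ≤ 2 ^ m)
    (hD : Fintype.card D ≤ Real.exp (2 ^ m)) :
    ∫⁻ z, ‖gaussMat A z‖ₑ ^ p ∂gaussianVec T
      ≤ ENNReal.ofReal (√(4 * Real.exp 1 * 2 ^ m) * κ) ^ p := by
  set q : ℕ := 2 ^ m with hq
  have hq0 : 0 < q := by positivity
  have hqr : (q : ℝ) = 2 ^ m := by simp [hq]
  rw [← hqr] at hpm hD ⊢
  have hint : Integrable (fun z => frobSq (gaussMat A z ^ q)) (gaussianVec T) := by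
    have h1 : ∀ z, frobSq (gaussMat A z ^ q) = ((gaussMat A z ^ (2 * q)).trace).re := fun z => by
      rw [trace_pow_two_mul (isHermitian_gaussMat A z), Complex.ofReal_re]
    simp_rw [h1]
    exact (integrable_trace_pow A (2 * q)).re
  have hmom : ∫⁻ z, ‖gaussMat A z‖ₑ ^ (2 * q : ℝ) ∂gaussianVec T
      ≤ ENNReal.ofReal (√(4 * Real.exp 1 * q) * κ) ^ (2 * q : ℝ) := by
    calc ∫⁻ z, ‖gaussMat A z‖ₑ ^ (2 * q : ℝ) ∂gaussianVec T
        ≤ ∫⁻ z, ENNReal.ofReal (frobSq (gaussMat A z ^ q)) ∂gaussianVec T := by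
          refine lintegral_mono fun z => ?_
          have := l2_opNorm_pow_le_frobSq (isHermitian_gaussMat A z) m
          rw [← ofReal_norm, ENNReal.ofReal_rpow_of_nonneg (norm_nonneg _) (by positivity)]
          refine ENNReal.ofReal_le_ofReal (le_trans (le_of_eq ?_) this)
          rw [← Real.rpow_natCast, hq]
          push_cast
          rfl
      _ = ENNReal.ofReal (∫ z, frobSq (gaussMat A z ^ q) ∂gaussianVec T) := by
          rw [ofReal_integral_eq_lintegral_ofReal hint]
          exact .of_forall fun z => Finset.sum_nonneg fun i _ =>
                Finset.sum_nonneg fun j _ => by positivity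
      _ ≤ ENNReal.ofReal ((4 * q * κ ^ 2) ^ q * Real.exp q) := by
          refine ENNReal.ofReal_le_ofReal ?_
          refine (integral_frobSq_pow_le A (sq_nonneg κ) hK q).trans ?_
          exact mul_le_mul_of_nonneg_left hD (by positivity)
      _ = _ := by
          rw [ENNReal.ofReal_rpow_of_nonneg (by positivity) (by positivity)]
          congr 1
          have : (2 * q : ℝ) = ((2 * q : ℕ) : ℝ) := by push_cast; ring
          rw [this, Real.rpow_natCast, pow_mul, mul_pow √_, Real.sq_sqrt (by positivity)]
          have h2 : Real.exp q = Real.exp 1 ^ q := by rw [← Real.exp_nat_mul, mul_one]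
          rw [h2, ← mul_pow]
          congr 1
          ring
  have hmeas : AEStronglyMeasurable (fun z => ‖gaussMat A z‖) (gaussianVec T) :=
    (continuous_gaussMat A).norm.aestronglyMeasurable
  have hle := eLpNorm'_le_eLpNorm'_of_exponent_le (by linarith : 0 < p)
    (by linarith : p ≤ (2 * q : ℝ)) (gaussianVec T) hmeas
  simp only [eLpNorm', enorm_norm] at hle
  have h2q : (0 : ℝ) < 2 * q := by positivity
  have h3 := hle.trans (ENNReal.rpow_le_rpow hmom (by positivity))
  rw [← ENNReal.rpow_mul, mul_one_div_cancel h2q.ne', ENNReal.rpow_one] at h3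
  have h4 := ENNReal.rpow_le_rpow h3 (by linarith : 0 ≤ p)
  rwa [← ENNReal.rpow_mul, one_div_mul_cancel (by linarith), ENNReal.rpow_one] at h4

/-- `z ^ ε` for a sign `ε`: `z` itself or its complex conjugate. -/
noncomputable def signConj (ε : ℤˣ) (z : ℂ) : ℂ := if ε = 1 then z else conj z

/-- The noncommutative Khintchine inequality for a Gaussian series of rectangular matrices, applied
at an exponent `p` that is at most a power `2 ^ m` of two exceeding the logarithm of the dimension.
The row and column norms are the operator norms of the tensor `H` with the index `t` put together
with the columns and with the rows, respectively. -/
theorem lintegral_norm_gaussian_sum_le [DecidableEq T] (H : T → Matrix S R ℂ) (ε : ℤˣ) {m : ℕ} {p : ℝ} (hp : 1 ≤ p)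
    (hpm : p ≤ 2 ^ m) (hD : (Fintype.card S + Fintype.card R : ℝ) ≤ Real.exp (2 ^ m)) :
    ∫⁻ z, ‖∑ t, signConj ε (z t) • H t‖ₑ ^ p ∂gaussianVec T
      ≤ (ENNReal.ofReal √(4 * Real.exp 1 * 2 ^ m) *
        max ‖(Matrix.of fun s (x : T × R) => H x.1 s x.2)‖ₑ
          ‖(Matrix.of fun (x : T × S) r => H x.1 x.2 r)‖ₑ) ^ p := by
  set Hr : Matrix S (T × R) ℂ := Matrix.of fun s (x : T × R) => H x.1 s x.2 with hHr
  set Hc : Matrix (T × S) R ℂ := Matrix.of fun (x : T × S) r => H x.1 x.2 r with hHc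
  set κ := max ‖Hr‖ ‖Hc‖
  have hκ : 0 ≤ κ := (norm_nonneg _).trans (le_max_left _ _)
  -- the Hermitian dilation
  let A₀ : T → Matrix (S ⊕ R) (S ⊕ R) ℂ := fun t => Matrix.fromBlocks 0 (H t) 0 0
  let A : T → Matrix (S ⊕ R) (S ⊕ R) ℂ := fun t => if ε = 1 then A₀ t else (A₀ t)ᴴ
  have hblock : ∀ z, ∑ t, signConj ε (z t) • H t = (gaussMat A z).submatrix Sum.inl Sum.inr := by
    intro z
    ext s r
    by_cases hε : ε = 1 <;>
      simp [gaussMat, Matrix.sum_apply, signConj, hε, A, A₀, Matrix.fromBlocks_conjTranspose]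
  have hA₀ : ∀ v : S ⊕ R → ℂ,
      ∑ t, (∑ i, ‖(A₀ t).mulVec v i‖ ^ 2 + ∑ i, ‖((A₀ t)ᴴ).mulVec v i‖ ^ 2)
        ≤ κ ^ 2 * ∑ i, ‖v i‖ ^ 2 := by
    intro v
    have e1 : ∑ t, ∑ i, ‖(A₀ t).mulVec v i‖ ^ 2
        = ∑ i, ‖Hc.mulVec (fun r => v (Sum.inr r)) i‖ ^ 2 := by
      rw [Fintype.sum_prod_type]
      simp [A₀, Matrix.fromBlocks_mulVec, Fintype.sum_sum_type, hHc, Function.comp_def]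
      rfl
    have e2 : ∑ t, ∑ i, ‖((A₀ t)ᴴ).mulVec v i‖ ^ 2
        = ∑ i, ‖(Hrᴴ).mulVec (fun s => v (Sum.inl s)) i‖ ^ 2 := by
      rw [Fintype.sum_prod_type]
      simp [A₀, Matrix.fromBlocks_mulVec, Fintype.sum_sum_type, hHr, Function.comp_def,
        Matrix.fromBlocks_conjTranspose]
      rfl
    rw [Finset.sum_add_distrib, e1, e2, Fintype.sum_sum_type]
    have f1 := sum_norm_mulVec_sq_le Hc (fun r => v (Sum.inr r))
    have f2 := sum_norm_mulVec_sq_le Hrᴴ (fun s => v (Sum.inl s))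
    rw [Matrix.l2_opNorm_conjTranspose] at f2
    have g1 : ‖Hc‖ ^ 2 ≤ κ ^ 2 := pow_le_pow_left₀ (norm_nonneg _) (le_max_right _ _) 2
    have g2 : ‖Hr‖ ^ 2 ≤ κ ^ 2 := pow_le_pow_left₀ (norm_nonneg _) (le_max_left _ _) 2
    have k1 : 0 ≤ ∑ r, ‖v (Sum.inr r)‖ ^ 2 := Finset.sum_nonneg fun _ _ => by positivity
    have k2 : 0 ≤ ∑ s, ‖v (Sum.inl s)‖ ^ 2 := Finset.sum_nonneg fun _ _ => by positivity
    have l1 := mul_le_mul_of_nonneg_right g1 k1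
    have l2 := mul_le_mul_of_nonneg_right g2 k2
    linarith
  have hA : ∀ v : S ⊕ R → ℂ,
      ∑ t, (∑ i, ‖(A t).mulVec v i‖ ^ 2 + ∑ i, ‖((A t)ᴴ).mulVec v i‖ ^ 2)
        ≤ κ ^ 2 * ∑ i, ‖v i‖ ^ 2 := by
    intro v
    by_cases hε : ε = 1
    · simpa [A, hε] using hA₀ v
    · refine le_of_eq_of_le ?_ (hA₀ v)
      refine Finset.sum_congr rfl fun t _ => ?_
      simp only [A, hε, if_false, Matrix.conjTranspose_conjTranspose]
      rw [add_comm]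
  have hκ' : max ‖Hr‖ₑ ‖Hc‖ₑ = ENNReal.ofReal κ := by
    rw [← ofReal_norm, ← ofReal_norm]
    exact (ENNReal.ofReal_mono.map_max).symm
  rw [hκ', ← ENNReal.ofReal_mul (Real.sqrt_nonneg _)]
  refine le_trans (lintegral_mono fun z => ?_)
    (lintegral_norm_gaussMat_le A hκ hA hp hpm (by simpa using hD))
  refine ENNReal.rpow_le_rpow ?_ (by linarith)
  rw [hblock, ← ofReal_norm, ← ofReal_norm]
  exact ENNReal.ofReal_le_ofReal
    (l2_opNorm_submatrix_le _ Sum.inl_injective Sum.inr_injective)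

end Khintchine

end

/-! ### Complex Hermite and Laguerre polynomials -/

section

open scoped ComplexConjugate

section Hermite

/-- The complex Hermite polynomial, i.e. the Wick power `:x^a y^b:` for Gaussian `x`, `y = conj x` of
covariance `E x y = 1`, as a polynomial expression in two elements of a commutative ring. The truncated `b - 1` comes with a
factor `b`, so its value for `b = 0` does not matter. -/
def cHermite {R : Type*} [CommRing R] (x y : R) : ℕ → ℕ → R
  | 0, b => y ^ b
  | a + 1, b => x * cHermite x y a b - b * cHermite x y a (b - 1)

variable {R : Type*} [CommRing R] (x y : R)

lemma cHermite_zero_left (b : ℕ) : cHermite x y 0 b = y ^ b := rfl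

lemma cHermite_succ_left (a b : ℕ) :
    cHermite x y (a + 1) b = x * cHermite x y a b - b * cHermite x y a (b - 1) := rfl

lemma mul_cHermite_pred (a b : ℕ) :
    (a : R) * (x * cHermite x y (a - 1) b)
      = a * cHermite x y a b + a * (b * cHermite x y (a - 1) (b - 1)) := by
  rcases a with _ | a
  · simp
  · rw [cHermite_succ_left, Nat.add_sub_cancel]
    ring

lemma cHermite_succ_right (a b : ℕ) :
    cHermite x y a (b + 1) = y * cHermite x y a b - a * cHermite x y (a - 1) b := by
  induction a generalizing b with
  | zero => simp [cHermite_zero_left, pow_succ']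
  | succ a ih =>
    rw [cHermite_succ_left, ih, cHermite_succ_left, Nat.add_sub_cancel, Nat.add_sub_cancel]
    have h1 := mul_cHermite_pred x y a b
    have h2 : (b : R) * (y * cHermite x y a (b - 1))
        = b * cHermite x y a b + b * (a * cHermite x y (a - 1) (b - 1)) := by
      rcases b with _ | b
      · simp
      · rw [ih, Nat.add_sub_cancel]
        ring
    push_cast
    linear_combination -h1 + h2

lemma cHermite_symm (a b : ℕ) : cHermite x y a b = cHermite y x b a := by
  induction a generalizing b with
  | zero =>
    induction b with
    | zero => simp [cHermite]
    | succ b ih => rw [cHermite_succ_right, ih, cHermite_succ_left]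
  | succ a ih => rw [cHermite_succ_left, ih, ih, cHermite_succ_right]

/-- The three-term recurrence along the diagonal `a - b = const`, which is that of the generalized
Laguerre polynomials in `x * y`. -/
lemma cHermite_succ_succ (a b : ℕ) :
    cHermite x y (a + 1) (b + 1) = (x * y - a - b - 1) * cHermite x y a b
      - a * b * cHermite x y (a - 1) (b - 1) := by
  rw [cHermite_succ_left, cHermite_succ_right, Nat.add_sub_cancel]
  have h1 := mul_cHermite_pred x y a b
  push_cast
  linear_combination -h1

lemma map_cHermite {R' : Type*} [CommRing R'] (f : R →+* R') (a b : ℕ) :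
    f (cHermite x y a b) = cHermite (f x) (f y) a b := by
  induction a generalizing b with
  | zero => simp [cHermite]
  | succ a ih => simp [cHermite, ih]

lemma derivation_cHermite {R₀ : Type*} [CommRing R₀] [Algebra R₀ R] (δ : Derivation R₀ R R)
    (a b : ℕ) : δ (cHermite x y a b)
      = a * cHermite x y (a - 1) b * δ x + b * cHermite x y a (b - 1) * δ y := by
  induction a generalizing b with
  | zero => simp [cHermite_zero_left, Derivation.leibniz_pow]; ring
  | succ a ih =>
    have h1 := mul_cHermite_pred x y a b
    have h2 : (b : R) * (((b - 1 : ℕ) : R) * cHermite x y a (b - 1 - 1))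
        = b * (x * cHermite x y a (b - 1)) - b * cHermite x y (a + 1) (b - 1) := by
      rw [cHermite_succ_left]
      ring
    rw [cHermite_succ_left, map_sub, Derivation.leibniz, Derivation.leibniz, ih, ih,
      Derivation.map_natCast, Nat.add_sub_cancel]
    simp only [smul_eq_mul]
    push_cast
    linear_combination (δ x) * h1 - (δ y) * h2

lemma cHermite_eq_genLaguerre (α m : ℕ) (z : ℂ) :
    cHermite z (conj z) (m + α) m
      = (((-1) ^ m * (m.factorial : ℝ) * genLaguerre α m (‖z‖ ^ 2) : ℝ) : ℂ) * z ^ α := by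
  have hz : z * conj z = ((‖z‖ ^ 2 : ℝ) : ℂ) := by
    rw [Complex.mul_conj, Complex.normSq_eq_norm_sq]
  induction m using Nat.twoStepInduction with
  | zero =>
    rw [cHermite_symm, cHermite_zero_left]
    simp [genLaguerre]
  | one =>
    have : 1 + α = (0 + α) + 1 := by ring
    rw [this]
    rw [cHermite_succ_succ, cHermite_symm, cHermite_zero_left, hz]
    simp [genLaguerre]
    left
    ring
  | more m ih1 ih2 =>
    have e1 : m + 2 + α = (m + 1 + α) + 1 := by ring
    rw [e1, cHermite_succ_succ, ih2, hz]
    have e2 : m + 1 + α - 1 = m + α := by omega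
    rw [e2, Nat.add_sub_cancel, ih1, genLaguerre, Nat.factorial_succ (m + 1), Nat.factorial_succ m]
    have h1 : (m + 1 + 1 : ℂ) ≠ 0 := by exact_mod_cast Nat.succ_ne_zero (m + 1)
    push_cast
    field_simp
    ring

/-- The Laguerre factor of a site that carries `a` signs `+1` and `b` signs `-1`. -/
lemma laguerreType_eq_cHermite (a b : ℕ) (z : ℂ) :
    laguerreType (a + b) ((a : ℤ) - b) z = cHermite z (conj z) a b := by
  rcases le_or_gt b a with h | h
  · obtain ⟨α, rfl⟩ := Nat.exists_eq_add_of_le h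
    have h1 : (((b + α : ℕ) : ℤ) - b) = (α : ℤ) := by push_cast; ring
    have h2 : (b + α + b - α) / 2 = b := by omega
    rw [h1, cHermite_eq_genLaguerre, laguerreType, Int.natAbs_natCast, h2, signedPow,
      if_pos (Int.natCast_nonneg α), Int.natAbs_natCast]
  · obtain ⟨α, rfl⟩ := Nat.exists_eq_add_of_le h.le
    have h1 : ((a : ℤ) - ((a + α : ℕ) : ℤ)) = -(α : ℤ) := by push_cast; ring
    have h2 : (a + (a + α) - α) / 2 = a := by omega
    have h3 : ¬ (0 : ℤ) ≤ -(α : ℤ) := by omega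
    have := cHermite_eq_genLaguerre α a (conj z)
    rw [Complex.conj_conj, Complex.norm_conj] at this
    rw [h1, cHermite_symm, this, laguerreType, Int.natAbs_neg, Int.natAbs_natCast, h2, signedPow,
      if_neg h3, Int.natAbs_neg, Int.natAbs_natCast]

end Hermite

end

/-! ### Rotated Hermite polynomials at one site -/

section

open scoped ComplexConjugate

section Decoupling
open MvPolynomial

lemma sqrt_two_div_two_sq : ((√2 / 2 : ℝ) : ℂ) ^ 2 = 1 / 2 := by
  rw [← Complex.ofReal_pow, div_pow, Real.sq_sqrt (by norm_num)]
  push_cast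
  norm_num

/-- The Hermite polynomial in `(s - z) / √2`, as a polynomial in `z` and `conj z`. -/
noncomputable def rotHermite (s : ℂ) (a b : ℕ) : MvPolynomial (Unit ⊕ Unit) ℂ :=
  cHermite (C ((√2 / 2 : ℝ) : ℂ) * (C s - X (Sum.inl ())))
    (C ((√2 / 2 : ℝ) : ℂ) * (C (conj s) - X (Sum.inr ()))) a b

lemma evalConj_rotHermite (s : ℂ) (a b : ℕ) (z : Unit → ℂ) :
    evalConj z (rotHermite s a b) = cHermite (((√2 / 2 : ℝ) : ℂ) * (s - z ()))
      (conj (((√2 / 2 : ℝ) : ℂ) * (s - z ()))) a b := by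
  rw [rotHermite, map_cHermite]
  simp only [map_mul, map_sub, evalConj_C, evalConj_X_inl, evalConj_X_inr, Complex.conj_ofReal]

lemma integral_X_inl_mul_rotHermite (s : ℂ) (a b : ℕ) :
    ∫ z, evalConj z (X (Sum.inl ()) * rotHermite s a b) ∂gaussianVec Unit
      = -((√2 / 2 : ℝ) : ℂ) * b * ∫ z, evalConj z (rotHermite s a (b - 1)) ∂gaussianVec Unit := by
  rw [integral_X_inl_mul, rotHermite, derivation_cHermite, ← integral_const_mul]
  congr 1 with z
  simp [rotHermite]
  ring

lemma integral_X_inr_mul_rotHermite (s : ℂ) (a b : ℕ) :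
    ∫ z, evalConj z (X (Sum.inr ()) * rotHermite s a b) ∂gaussianVec Unit
      = -((√2 / 2 : ℝ) : ℂ) * a * ∫ z, evalConj z (rotHermite s (a - 1) b) ∂gaussianVec Unit := by
  rw [integral_X_inr_mul, rotHermite, derivation_cHermite, ← integral_const_mul]
  congr 1 with z
  simp [rotHermite]
  ring

lemma integral_C_mul_rotHermite (c : ℂ) (P : MvPolynomial (Unit ⊕ Unit) ℂ) :
    ∫ z, evalConj z (C c * P) ∂gaussianVec Unit = c * ∫ z, evalConj z P ∂gaussianVec Unit := by
  simp only [map_mul, evalConj_C, integral_const_mul]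

/-- Bookkeeping of the powers of `c = 1 / √2` in `b * f (b - 1)`, uniformly in `b = 0` and `b > 0`. -/
lemma mul_pow_pred (c : ℂ) (hc : c ^ 2 = 1 / 2) (a b : ℕ) (f : ℕ → ℂ) :
    (b : ℂ) * (c ^ (a + (b - 1)) * f (b - 1)) = 2 * c ^ (a + b + 1) * b * f (b - 1) := by
  rcases b with _ | b
  · simp
  · have : c ^ (a + (b + 1) + 1) = c ^ (a + b) * c ^ 2 := by ring
    rw [this, hc, Nat.add_sub_cancel]
    ring

/-- Averaging over `z` removes it from a Hermite polynomial in `(s - z) / √2`, up to scaling. -/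
lemma integral_rotHermite (s : ℂ) (a b : ℕ) :
    ∫ z, evalConj z (rotHermite s a b) ∂gaussianVec Unit
      = ((√2 / 2 : ℝ) : ℂ) ^ (a + b) * cHermite s (conj s) a b := by
  set c : ℂ := ((√2 / 2 : ℝ) : ℂ) with hc
  have hc2 : c ^ 2 = 1 / 2 := sqrt_two_div_two_sq
  induction a generalizing b with
  | zero =>
    induction b with
    | zero => simp [rotHermite, cHermite]
    | succ b ih =>
      have h1 : rotHermite s 0 (b + 1) = C (c * conj s) * rotHermite s 0 b
          - C c * (X (Sum.inr ()) * rotHermite s 0 b) := by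
        rw [rotHermite, cHermite_succ_right, ← hc, C_mul]
        simp only [Nat.cast_zero, zero_mul, sub_zero, rotHermite, ← hc]
        ring
      simp only [h1, map_sub]
      rw [integral_sub (integrable_evalConj _) (integrable_evalConj _),
        integral_C_mul_rotHermite, integral_C_mul_rotHermite, integral_X_inr_mul_rotHermite, ih]
      simp only [cHermite_zero_left]
      push_cast
      ring
  | succ a ih =>
    have h1 : rotHermite s (a + 1) b = C (c * s) * rotHermite s a b
        - C c * (X (Sum.inl ()) * rotHermite s a b) - C (b : ℂ) * rotHermite s a (b - 1) := by
      rw [rotHermite, cHermite_succ_left, ← hc, C_mul, map_natCast]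
      simp only [rotHermite, ← hc]
      ring
    simp only [h1, map_sub]
    rw [integral_sub (by
        simp only [← map_sub]; exact integrable_evalConj _) (integrable_evalConj _),
      integral_sub (integrable_evalConj _) (integrable_evalConj _),
      integral_C_mul_rotHermite, integral_C_mul_rotHermite, integral_C_mul_rotHermite,
      integral_X_inl_mul_rotHermite, ih, ih, cHermite_succ_left, ← hc]
    have h2 := mul_pow_pred c hc2 a b (fun b => cHermite s (conj s) a b)
    have h3 : c ^ (a + 1 + b) = c * c ^ (a + b) := by ring
    linear_combination (c ^ 2 - 1) * h2 + (2 * c ^ (a + b + 1) * b * cHermite s (conj s) a (b - 1)) * hc2 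

/-- An extra factor `(s + z) / √2` raises the first degree by one. The sign is the point: the
correlation of `s + z` with `s - z` produces exactly the Wick correction. -/
lemma integral_add_mul_rotHermite (s : ℂ) (a b : ℕ) :
    ∫ z, evalConj z (C ((√2 / 2 : ℝ) : ℂ) * (C s + X (Sum.inl ())) * rotHermite s a b)
        ∂gaussianVec Unit
      = ((√2 / 2 : ℝ) : ℂ) ^ (a + 1 + b) * cHermite s (conj s) (a + 1) b := by
  set c : ℂ := ((√2 / 2 : ℝ) : ℂ) with hc
  have hc2 : c ^ 2 = 1 / 2 := sqrt_two_div_two_sq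
  have h1 : C c * (C s + X (Sum.inl ())) * rotHermite s a b = C (c * s) * rotHermite s a b
        + C c * (X (Sum.inl ()) * rotHermite s a b) := by rw [C_mul]; ring
  simp only [h1, map_add]
  rw [integral_add (integrable_evalConj _) (integrable_evalConj _),
      integral_C_mul_rotHermite, integral_C_mul_rotHermite,
      integral_X_inl_mul_rotHermite, integral_rotHermite, integral_rotHermite, cHermite_succ_left,
      ← hc]
  have h2 := mul_pow_pred c hc2 a b (fun b => cHermite s (conj s) a b)
  linear_combination (-c ^ 2) * h2 - (2 * c ^ (a + b + 1) * b * cHermite s (conj s) a (b - 1)) * hc2 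

/-- An extra factor `conj (s + z) / √2` raises the second degree by one. -/
lemma integral_conj_add_mul_rotHermite (s : ℂ) (a b : ℕ) :
    ∫ z, evalConj z (C ((√2 / 2 : ℝ) : ℂ) * (C (conj s) + X (Sum.inr ())) * rotHermite s a b)
        ∂gaussianVec Unit
      = ((√2 / 2 : ℝ) : ℂ) ^ (a + (b + 1)) * cHermite s (conj s) a (b + 1) := by
  set c : ℂ := ((√2 / 2 : ℝ) : ℂ) with hc
  have hc2 : c ^ 2 = 1 / 2 := sqrt_two_div_two_sq
  have h1 : C c * (C (conj s) + X (Sum.inr ())) * rotHermite s a b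
      = C (c * conj s) * rotHermite s a b
        + C c * (X (Sum.inr ()) * rotHermite s a b) := by rw [C_mul]; ring
  simp only [h1, map_add]
  rw [integral_add (integrable_evalConj _) (integrable_evalConj _),
      integral_C_mul_rotHermite, integral_C_mul_rotHermite,
      integral_X_inr_mul_rotHermite, integral_rotHermite, integral_rotHermite, cHermite_succ_right,
      ← hc]
  have h2 := mul_pow_pred c hc2 b a (fun a => cHermite s (conj s) a b)
  rw [add_comm b (a - 1), add_comm b a] at h2
  linear_combination (-c ^ 2) * h2 - (2 * c ^ (a + b + 1) * a * cHermite s (conj s) (a - 1) b) * hc2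

end Decoupling

end

/-! ### Wick products and their decoupling -/

section

open scoped ComplexConjugate

section WickProduct
open MvPolynomial

variable {T : Type*} [DecidableEq T] {k : ℕ}

/-- The number of `j` with `n_j = t` and sign `ι_j = ε`. -/
def signCount (ε : ℤˣ) (ι : Fin k → ℤˣ) (n : Fin k → T) (t : T) : ℕ :=
  (Finset.univ.filter fun j => n j = t ∧ ι j = ε).card

lemma signCount_cons (ε : ℤˣ) (ι : Fin (k + 1) → ℤˣ) (n : Fin k → T) (t₀ t : T) :
    signCount ε ι (Fin.cons t₀ n) t
      = signCount ε (fun j => ι j.succ) n t + if t₀ = t ∧ ι 0 = ε then 1 else 0 := by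
  simp only [signCount, Finset.card_filter, Fin.sum_univ_succ, Fin.cons_zero, Fin.cons_succ]
  ring

variable [Fintype T]

lemma sum_signCount (ι : Fin k → ℤˣ) (n : Fin k → T) :
    ∑ t, (signCount 1 ι n t + signCount (-1) ι n t) = k := by
  simp only [signCount, Finset.card_filter, ← Finset.sum_add_distrib]
  rw [Finset.sum_comm]
  have : ∀ j : Fin k, ∑ t, ((if n j = t ∧ ι j = 1 then 1 else 0)
      + if n j = t ∧ ι j = -1 then 1 else 0) = 1 := by
    intro j
    rw [Finset.sum_eq_single (n j)]
    · rcases Int.units_eq_one_or (ι j) with h | h <;> simp [h]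
    · intro t _ ht
      simp [ht.symm]
    · simp
  simp [this]

/-- The Wick product of the `z_{n_j}^{ι_j}`, for `n_j` in a finite set of sites. -/
noncomputable def wick (ι : Fin k → ℤˣ) (n : Fin k → T) (z : T → ℂ) : ℂ :=
  ∏ t, cHermite (z t) (conj (z t)) (signCount 1 ι n t) (signCount (-1) ι n t)

lemma continuous_cHermite (a b : ℕ) : Continuous fun z : ℂ => cHermite z (conj z) a b := by
  induction a generalizing b with
  | zero => simp only [cHermite]; fun_prop
  | succ a ih =>
    simp only [cHermite]
    exact (continuous_id.mul (ih b)).sub (continuous_const.mul (ih _))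

lemma continuous_wick (ι : Fin k → ℤˣ) (n : Fin k → T) : Continuous (wick ι n) :=
  continuous_finsetProd _ fun t _ => (continuous_cHermite _ _).comp (continuous_apply t)

lemma integrable_evalConj_const (P : MvPolynomial (Unit ⊕ Unit) ℂ) :
    Integrable (fun w => evalConj (fun _ => w) P) stdComplexGaussian := by
  have h := measurePreserving_funUnique stdComplexGaussian Unit
  rw [← h.integrable_comp_emb (MeasurableEquiv.measurableEmbedding _)]
  exact integrable_evalConj P

lemma integral_evalConj_const (P : MvPolynomial (Unit ⊕ Unit) ℂ) :
    ∫ w, evalConj (fun _ => w) P ∂stdComplexGaussian = ∫ z, evalConj z P ∂gaussianVec Unit := by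
  have h := measurePreserving_funUnique stdComplexGaussian Unit
  rw [← h.integral_comp' (g := fun w => evalConj (fun _ => w) P)]
  rfl

/-- The factor at one site `t` of the decoupled product, where `first` says whether the decoupled
index sits at this site. -/
noncomputable def decoupledSite (first : Prop) [Decidable first] (ε : ℤˣ) (s : ℂ) (a b : ℕ) :
    MvPolynomial (Unit ⊕ Unit) ℂ :=
  (if first then
    if ε = 1 then C ((√2 / 2 : ℝ) : ℂ) * (C s + X (Sum.inl ()))
    else C ((√2 / 2 : ℝ) : ℂ) * (C (conj s) + X (Sum.inr ()))
  else 1) * rotHermite s a b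

lemma integral_decoupledSite (first : Prop) [Decidable first] (ε : ℤˣ) (s : ℂ) (a b : ℕ) :
    ∫ w, evalConj (fun _ => w) (decoupledSite first ε s a b) ∂stdComplexGaussian
      = ((√2 / 2 : ℝ) : ℂ) ^ ((a + if first ∧ ε = 1 then 1 else 0)
          + (b + if first ∧ ε = -1 then 1 else 0))
        * cHermite s (conj s) (a + if first ∧ ε = 1 then 1 else 0)
          (b + if first ∧ ε = -1 then 1 else 0) := by
  rw [integral_evalConj_const, decoupledSite]
  have h11 : (-1 : ℤˣ) ≠ 1 := by decide
  by_cases h : first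
  · rcases Int.units_eq_one_or ε with rfl | rfl
    · simpa [h, h11.symm] using integral_add_mul_rotHermite s a b
    · simpa [h, h11] using integral_conj_add_mul_rotHermite s a b
  · simpa [h] using integral_rotHermite s a b

lemma signConj_mul_wick_eq_prod (ι : Fin (k + 1) → ℤˣ) (t₀ : T) (n : Fin k → T) (w s : T → ℂ) :
    signConj (ι 0) (((√2 / 2) • w + (√2 / 2) • s) t₀)
        * wick (fun j => ι j.succ) n (-(√2 / 2) • w + (√2 / 2) • s)
      = ∏ t, evalConj (fun _ => w t) (decoupledSite (t₀ = t) (ι 0) (s t)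
          (signCount 1 (fun j => ι j.succ) n t) (signCount (-1) (fun j => ι j.succ) n t)) := by
  simp only [decoupledSite, map_mul, Finset.prod_mul_distrib]
  congr 1
  · rw [Finset.prod_eq_single t₀]
    · have h0 : ((√2 / 2) • w + (√2 / 2) • s) t₀ = ((√2 / 2 : ℝ) : ℂ) * (s t₀ + w t₀) := by
        simp
        ring
      rw [h0]
      by_cases h : ι 0 = 1
      · simp [h, signConj]
      · simp [h, signConj, -Complex.ofReal_div, Complex.conj_ofReal]
    · intro t _ ht
      simp [ht.symm]
    · simp
  · refine Finset.prod_congr rfl fun t _ => ?_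
    rw [evalConj_rotHermite]
    have : (-(√2 / 2) • w + (√2 / 2) • s) t = ((√2 / 2 : ℝ) : ℂ) * (s t - w t) := by
      simp
      ring
    rw [this]

lemma integrable_signConj_mul_wick (ι : Fin (k + 1) → ℤˣ) (t₀ : T) (n : Fin k → T) (s : T → ℂ) :
    Integrable (fun w => signConj (ι 0) (((√2 / 2) • w + (√2 / 2) • s) t₀)
        * wick (fun j => ι j.succ) n (-(√2 / 2) • w + (√2 / 2) • s)) (gaussianVec T) := by
  simp only [signConj_mul_wick_eq_prod]
  exact Integrable.fintype_prod fun t => integrable_evalConj_const _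

/-- Splitting off one factor of a Wick product: with `g₁ = (w + s) / √2` and `g₂ = (s - w) / √2`,
averaging over `w` turns `g₁` times a Wick product in `g₂` into the full Wick product in `s`. -/
lemma integral_signConj_mul_wick (ι : Fin (k + 1) → ℤˣ) (t₀ : T) (n : Fin k → T) (s : T → ℂ) :
    ∫ w, signConj (ι 0) (((√2 / 2) • w + (√2 / 2) • s) t₀)
        * wick (fun j => ι j.succ) n (-(√2 / 2) • w + (√2 / 2) • s) ∂gaussianVec T
      = ((√2 / 2 : ℝ) : ℂ) ^ (k + 1) * wick ι (Fin.cons t₀ n : Fin (k + 1) → T) s := by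
  simp only [signConj_mul_wick_eq_prod]
  rw [integral_fintype_prod_eq_prod (f := fun t w => evalConj (fun _ => w)
    (decoupledSite (t₀ = t) (ι 0) (s t) (signCount 1 (fun j => ι j.succ) n t)
      (signCount (-1) (fun j => ι j.succ) n t)))]
  simp only [integral_decoupledSite, Finset.prod_mul_distrib, wick, ← signCount_cons]
  rw [Finset.prod_pow_eq_pow_sum, sum_signCount]

end WickProduct

section RenormProd

variable {d k : ℕ}

/-- If all indices lie in a finite set `B`, only the sites of `B` contribute to the renormalized
product. -/
lemma renormProd_eq_wick (B : Finset (Fin d → ℤ)) (ι : Fin k → ℤˣ) (g : (Fin d → ℤ) → ℂ)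
    (n : Fin k → B) :
    renormProd ι g (fun j => (n j : Fin d → ℤ)) = wick ι n (fun t => g t) := by
  have hcount : ∀ t : B, laguerreType (indexCount (fun j => (n j : Fin d → ℤ)) t)
      (signedCount ι (fun j => (n j : Fin d → ℤ)) t) (g t)
      = cHermite (g t) (conj (g t)) (signCount 1 ι n t) (signCount (-1) ι n t) := by
    intro t
    rw [← laguerreType_eq_cHermite]
    have h11 : (-1 : ℤˣ) ≠ 1 := by decide
    congr 1
    · simp only [indexCount, signCount, Finset.card_filter, ← Finset.sum_add_distrib]
      refine Finset.sum_congr rfl fun j _ => ?_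
      rcases Int.units_eq_one_or (ι j) with h | h <;> simp [h, h11, h11.symm]
    · simp only [signedCount, signCount, Finset.card_filter, Finset.sum_filter]
      push_cast
      rw [← Finset.sum_sub_distrib]
      refine Finset.sum_congr rfl fun j _ => ?_
      rcases Int.units_eq_one_or (ι j) with h | h <;> simp [h, h11, h11.symm]
      split_ifs <;> simp
  rw [renormProd, finprod_eq_prod_of_mulSupport_subset (s := B), wick, ← Finset.prod_coe_sort]
  · exact Finset.prod_congr rfl fun t _ => hcount t
  · intro t ht
    by_contra htB
    refine ht ?_
    have h0 : Finset.univ.filter (fun j => (n j : Fin d → ℤ) = t) = ∅ := by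
      refine Finset.filter_eq_empty_iff.2 fun j _ h => htB ?_
      rw [← h]
      exact (n j).2
    simp [indexCount, signedCount, h0, laguerreType, genLaguerre, signedPow]

end RenormProd

end

/-! ### Moments of matrix-valued chaoses -/

section

open scoped ComplexConjugate Matrix.Norms.L2Operator

section Induction

/-- Jensen's inequality for the power function and a probability measure. -/
lemma rpow_lintegral_le {α : Type*} [MeasurableSpace α] (μ : Measure α) [IsProbabilityMeasure μ]
    {f : α → ℝ≥0∞} (hf : AEMeasurable f μ) {p : ℝ} (hp : 1 ≤ p) :
    (∫⁻ x, f x ∂μ) ^ p ≤ ∫⁻ x, f x ^ p ∂μ := by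
  have h := eLpNorm'_le_eLpNorm'_of_exponent_le one_pos hp μ (f := f) hf.aestronglyMeasurable
  simp only [eLpNorm', enorm_eq_self, ENNReal.rpow_one, div_one] at h
  have h4 := ENNReal.rpow_le_rpow h (by linarith : 0 ≤ p)
  rwa [← ENNReal.rpow_mul, one_div_mul_cancel (by linarith), ENNReal.rpow_one] at h4

variable {T R S : Type*} [Fintype T] [DecidableEq T] {k : ℕ}

/-- The chaos `∑_n h_n :∏_j z_{n_j}^{ι_j}:` with matrix coefficients `h_n`. -/
noncomputable def wickSum (ι : Fin k → ℤˣ) (h : (Fin k → T) → Matrix S R ℂ) (z : T → ℂ) :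
    Matrix S R ℂ :=
  ∑ n, wick ι n z • h n

lemma continuous_wickSum [Fintype R] [DecidableEq R] [Fintype S] (ι : Fin k → ℤˣ) (h : (Fin k → T) → Matrix S R ℂ) :
    Continuous (wickSum ι h) :=
  continuous_finsetSum _ fun n _ => (continuous_wick ι n).smul continuous_const

lemma continuous_signConj (ε : ℤˣ) : Continuous (signConj ε) := by
  unfold signConj
  split_ifs <;> fun_prop

lemma sum_fin_succ_pi {T M : Type*} [Fintype T] [AddCommMonoid M] (f : (Fin (k + 1) → T) → M) :
    ∑ n, f n = ∑ t, ∑ n : Fin k → T, f (Fin.cons t n) := by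
  rw [← Fintype.sum_prod_type', ← (Fin.consEquiv fun _ : Fin (k + 1) => T).sum_comp]
  rfl

variable [Fintype R] [DecidableEq R] [Fintype S]

/-- The conditional expectation formula for a chaos of order `k + 1` in terms of a Gaussian sum whose
coefficients are independent chaoses of order `k`. -/
lemma integral_decoupled_wickSum (ι : Fin (k + 1) → ℤˣ) (h : (Fin (k + 1) → T) → Matrix S R ℂ)
    (s : T → ℂ) :
    ∫ w, ∑ t, signConj (ι 0) (((√2 / 2) • w + (√2 / 2) • s) t) •
        wickSum (fun j => ι j.succ) (fun n => h (Fin.cons t n)) (-(√2 / 2) • w + (√2 / 2) • s)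
        ∂gaussianVec T
      = ((√2 / 2 : ℝ) : ℂ) ^ (k + 1) • wickSum ι h s := by
  simp only [wickSum, Finset.smul_sum, smul_smul]
  rw [sum_fin_succ_pi, integral_finsetSum _ fun t _ => integrable_finsetSum _ fun n _ =>
    (integrable_signConj_mul_wick ι t n s).smul_const _]
  refine Finset.sum_congr rfl fun t _ => ?_
  rw [integral_finsetSum _ fun n _ => (integrable_signConj_mul_wick ι t n s).smul_const _]
  refine Finset.sum_congr rfl fun n _ => ?_
  rw [integral_smul_const, integral_signConj_mul_wick]

variable [DecidableEq S]

/-- The chaos with the first random index put together with the columns. -/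
def rowFlatten (h : (Fin (k + 1) → T) → Matrix S R ℂ) (n : Fin k → T) : Matrix S (T × R) ℂ :=
  Matrix.of fun s x => h (Fin.cons x.1 n) s x.2

/-- The chaos with the first random index put together with the rows. -/
def colFlatten (h : (Fin (k + 1) → T) → Matrix S R ℂ) (n : Fin k → T) : Matrix (T × S) R ℂ :=
  Matrix.of fun y r => h (Fin.cons y.1 n) y.2 r

/-- One step of the induction on the order of the chaos: decoupling of the first index by Jensen's
inequality, followed by the noncommutative Khintchine inequality. -/
lemma lintegral_wickSum_succ_le (ι : Fin (k + 1) → ℤˣ) (h : (Fin (k + 1) → T) → Matrix S R ℂ)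
    {m : ℕ} {p : ℝ} (hp : 1 ≤ p) (hpm : p ≤ 2 ^ m)
    (hD : (Fintype.card S + Fintype.card R : ℝ) ≤ Real.exp (2 ^ m)) :
    ∫⁻ z, ‖wickSum ι h z‖ₑ ^ p ∂gaussianVec T
      ≤ (2 ^ (k + 1) * ENNReal.ofReal √(4 * Real.exp 1 * 2 ^ m)) ^ p *
        (∫⁻ z, ‖wickSum (fun j => ι j.succ) (rowFlatten h) z‖ₑ ^ p ∂gaussianVec T
          + ∫⁻ z, ‖wickSum (fun j => ι j.succ) (colFlatten h) z‖ₑ ^ p ∂gaussianVec T) := by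
  have hp0 : 0 ≤ p := by linarith
  set Q := ENNReal.ofReal √(4 * Real.exp 1 * 2 ^ m) with hQ
  set Y : (T → ℂ) × (T → ℂ) → Matrix S R ℂ := fun x => ∑ t, signConj (ι 0) (x.1 t) •
    wickSum (fun j => ι j.succ) (fun n => h (Fin.cons t n)) x.2 with hY
  have hYc : Continuous Y := by
    refine continuous_finsetSum _ fun t _ => ?_
    have h1 : Continuous fun x : (T → ℂ) × (T → ℂ) => signConj (ι 0) (x.1 t) :=
      (continuous_signConj _).comp ((continuous_apply t).comp continuous_fst)
    have h2 : Continuous fun x : (T → ℂ) × (T → ℂ) =>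
        wickSum (fun j => ι j.succ) (fun n => h (Fin.cons t n)) x.2 :=
      (continuous_wickSum _ _).comp continuous_snd
    exact h1.smul h2
  have hYm : Measurable fun x => ‖Y x‖ₑ ^ p := by
    have := hYc.enorm.measurable
    fun_prop
  set ρ : (T → ℂ) × (T → ℂ) → (T → ℂ) × (T → ℂ) := fun x =>
    ((√2 / 2) • x.1 + (√2 / 2) • x.2, -(√2 / 2) • x.1 + (√2 / 2) • x.2) with hρ
  have hρm := measurePreserving_rotate_gaussianVec (T := T)
  have hYρ : Measurable fun x => ‖Y (ρ x)‖ₑ ^ p := hYm.comp hρm.measurable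
  have hpt : ∀ s, ‖wickSum ι h s‖ₑ ^ p
      ≤ (2 ^ (k + 1)) ^ p * ∫⁻ w, ‖Y (ρ (w, s))‖ₑ ^ p ∂gaussianVec T := by
    intro s
    have h1 := integral_decoupled_wickSum ι h s
    have h2 : ‖((√2 / 2 : ℝ) : ℂ) ^ (k + 1) • wickSum ι h s‖ₑ
        ≤ ∫⁻ w, ‖Y (ρ (w, s))‖ₑ ∂gaussianVec T := by
      rw [← h1]
      exact enorm_integral_le_lintegral_enorm _
    have h3 : ‖wickSum ι h s‖ₑ ≤ 2 ^ (k + 1) * ‖((√2 / 2 : ℝ) : ℂ) ^ (k + 1) • wickSum ι h s‖ₑ := by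
      have h4 : (1 : ℝ) ≤ 2 ^ (k + 1) * (√2 / 2) ^ (k + 1) := by
        rw [← mul_pow, mul_div_cancel₀ _ (two_ne_zero)]
        exact one_le_pow₀ (Real.one_le_sqrt.2 (by norm_num))
      rw [← ofReal_norm, ← ofReal_norm, norm_smul, norm_pow, Complex.norm_real, Real.norm_eq_abs,
        abs_of_nonneg (by positivity),
        show (2 : ℝ≥0∞) ^ (k + 1) = ENNReal.ofReal (2 ^ (k + 1)) by
          rw [ENNReal.ofReal_pow (by norm_num)]; simp,
        ← ENNReal.ofReal_mul (by positivity), ← mul_assoc]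
      exact ENNReal.ofReal_le_ofReal (le_mul_of_one_le_left (norm_nonneg _) h4)
    have h5 : AEMeasurable (fun w => ‖Y (ρ (w, s))‖ₑ) (gaussianVec T) := by
      have : Continuous fun w => Y (ρ (w, s)) := hYc.comp (by simp only [hρ]; fun_prop)
      exact this.enorm.measurable.aemeasurable
    calc ‖wickSum ι h s‖ₑ ^ p
        ≤ (2 ^ (k + 1) * ∫⁻ w, ‖Y (ρ (w, s))‖ₑ ∂gaussianVec T) ^ p :=
          ENNReal.rpow_le_rpow (h3.trans (mul_le_mul_right h2 _)) hp0
      _ = (2 ^ (k + 1)) ^ p * (∫⁻ w, ‖Y (ρ (w, s))‖ₑ ∂gaussianVec T) ^ p :=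
          ENNReal.mul_rpow_of_nonneg _ _ hp0
      _ ≤ _ := mul_le_mul_right (rpow_lintegral_le _ h5 hp) _
  have hrow : ∀ y, (Matrix.of fun s (x : T × R) =>
      wickSum (fun j => ι j.succ) (fun n => h (Fin.cons x.1 n)) y s x.2)
      = wickSum (fun j => ι j.succ) (rowFlatten h) y := by
    intro y
    ext s x
    simp [wickSum, rowFlatten, Matrix.sum_apply]
  have hcol : ∀ y, (Matrix.of fun (x : T × S) r =>
      wickSum (fun j => ι j.succ) (fun n => h (Fin.cons x.1 n)) y x.2 r)
      = wickSum (fun j => ι j.succ) (colFlatten h) y := by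
    intro y
    ext x r
    simp [wickSum, colFlatten, Matrix.sum_apply]
  calc ∫⁻ z, ‖wickSum ι h z‖ₑ ^ p ∂gaussianVec T
      ≤ ∫⁻ s, (2 ^ (k + 1)) ^ p * ∫⁻ w, ‖Y (ρ (w, s))‖ₑ ^ p ∂gaussianVec T ∂gaussianVec T :=
        lintegral_mono hpt
    _ = (2 ^ (k + 1)) ^ p * ∫⁻ s, ∫⁻ w, ‖Y (ρ (w, s))‖ₑ ^ p ∂gaussianVec T ∂gaussianVec T :=
        lintegral_const_mul' _ _ (by simp)
    _ = (2 ^ (k + 1)) ^ p * ∫⁻ x, ‖Y (ρ x)‖ₑ ^ p ∂(gaussianVec T).prod (gaussianVec T) := by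
        rw [lintegral_prod_symm _ hYρ.aemeasurable]
    _ = (2 ^ (k + 1)) ^ p * ∫⁻ x, ‖Y x‖ₑ ^ p ∂(gaussianVec T).prod (gaussianVec T) := by
        rw [← hρm.lintegral_comp hYm]
    _ = (2 ^ (k + 1)) ^ p * ∫⁻ y, ∫⁻ x, ‖Y (x, y)‖ₑ ^ p ∂gaussianVec T ∂gaussianVec T := by
        rw [lintegral_prod_symm _ hYm.aemeasurable]
    _ ≤ (2 ^ (k + 1)) ^ p * ∫⁻ y, Q ^ p *
          (‖wickSum (fun j => ι j.succ) (rowFlatten h) y‖ₑ ^ p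
            + ‖wickSum (fun j => ι j.succ) (colFlatten h) y‖ₑ ^ p) ∂gaussianVec T := by
        refine mul_le_mul_right (lintegral_mono fun y => ?_) _
        refine (lintegral_norm_gaussian_sum_le (fun t => wickSum (fun j => ι j.succ)
          (fun n => h (Fin.cons t n)) y) (ι 0) hp hpm hD).trans ?_
        rw [hrow, hcol, ENNReal.mul_rpow_of_nonneg _ _ hp0,
          (ENNReal.monotone_rpow_of_nonneg hp0).map_max]
        exact mul_le_mul_right (max_le le_self_add le_add_self) _
    _ = _ := by
        rw [lintegral_const_mul' _ _
          (ENNReal.rpow_ne_top_of_nonneg hp0 ENNReal.ofReal_ne_top), lintegral_add_left, ← mul_assoc,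
          ENNReal.mul_rpow_of_nonneg _ _ hp0]
        have := (continuous_wickSum (fun j => ι j.succ) (rowFlatten h)).enorm.measurable
        fun_prop

end Induction

section Flatten

variable {T R S : Type*} {k : ℕ}

/-- The index `n ∈ T^k` whose coordinates are `x_j` for `j ∈ X` and `y_j` for `j ∉ X`. -/
def mergeFin (X : Finset (Fin k)) (x : X → T) (y : (Xᶜ : Finset (Fin k)) → T) : Fin k → T :=
  fun j => if hj : j ∈ X then x ⟨j, hj⟩ else y ⟨j, Finset.mem_compl.2 hj⟩

/-- The matrix obtained from `h` by putting the random indices in `X` together with the columns and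
the other ones together with the rows. -/
def flatten (h : (Fin k → T) → Matrix S R ℂ) (X : Finset (Fin k)) :
    Matrix (((Xᶜ : Finset (Fin k)) → T) × S) ((X → T) × R) ℂ :=
  Matrix.of fun y x => h (mergeFin X x.1 y.1) y.2 x.2

/-- The value `a` fills the coordinates that `mergeFin` does not read. -/
lemma mergeFin_cons_insert (t a : T) (X : Finset (Fin k)) (x : X → T)
    (y : (Xᶜ : Finset (Fin k)) → T) :
    mergeFin (insert 0 (X.map (Fin.succEmb k)))
      (fun j => (Fin.cons t (mergeFin X x fun _ => a) : Fin (k + 1) → T) j)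
      (fun j => (Fin.cons a (mergeFin X (fun _ => a) y) : Fin (k + 1) → T) j)
      = Fin.cons t (mergeFin X x y) := by
  ext j
  refine Fin.cases ?_ (fun j => ?_) j
  · simp [mergeFin]
  · by_cases hj : j ∈ X <;> simp [mergeFin, hj]

/-- The value `a` fills the coordinates that `mergeFin` does not read. -/
lemma mergeFin_cons_map (t a : T) (X : Finset (Fin k)) (x : X → T)
    (y : (Xᶜ : Finset (Fin k)) → T) :
    mergeFin (X.map (Fin.succEmb k))
      (fun j => (Fin.cons a (mergeFin X x fun _ => a) : Fin (k + 1) → T) j)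
      (fun j => (Fin.cons t (mergeFin X (fun _ => a) y) : Fin (k + 1) → T) j)
      = Fin.cons t (mergeFin X x y) := by
  ext j
  refine Fin.cases ?_ (fun j => ?_) j
  · simp [mergeFin]
  · by_cases hj : j ∈ X <;> simp [mergeFin, hj]

variable [Fintype T] [DecidableEq T] [Fintype R] [DecidableEq R] [Fintype S]

/-- Flattenings of `rowFlatten h` are flattenings of `h` with the first index among the columns. -/
lemma norm_flatten_rowFlatten_le [Nonempty T] (h : (Fin (k + 1) → T) → Matrix S R ℂ)
    (X : Finset (Fin k)) :
    ‖flatten (rowFlatten h) X‖ ≤ ‖flatten h (insert 0 (X.map (Fin.succEmb k)))‖ := by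
  obtain ⟨a⟩ := ‹Nonempty T›
  set X' := insert 0 (X.map (Fin.succEmb k)) with hX'
  let e : ((Xᶜ : Finset (Fin k)) → T) × S → ((X'ᶜ : Finset (Fin (k + 1))) → T) × S := fun y =>
    (fun j => (Fin.cons a (mergeFin X (fun _ => a) y.1) : Fin (k + 1) → T) j, y.2)
  let f : (X → T) × (T × R) → (X' → T) × R := fun x =>
    (fun j => (Fin.cons x.2.1 (mergeFin X x.1 fun _ => a) : Fin (k + 1) → T) j, x.2.2)
  have he : e.Injective := by
    rintro ⟨y, s⟩ ⟨y', s'⟩ h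
    simp only [e, Prod.mk.injEq] at h
    refine Prod.ext (funext fun j => ?_) h.2
    have hj := Finset.mem_compl.1 j.2
    have := congrFun h.1 ⟨j.1.succ, by simp [hX', hj]⟩
    simpa [mergeFin, hj] using this
  have hf : f.Injective := by
    rintro ⟨x, t, r⟩ ⟨x', t', r'⟩ h
    simp only [f, Prod.mk.injEq] at h
    have h0 := congrFun h.1 ⟨0, by simp [hX']⟩
    refine Prod.ext (funext fun j => ?_) (Prod.ext (by simpa using h0) h.2)
    have := congrFun h.1 ⟨j.1.succ, by simp [hX']⟩
    simpa [mergeFin] using this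
  have hsub : flatten (rowFlatten h) X = (flatten h X').submatrix e f := by
    ext y x
    simp only [flatten, rowFlatten, Matrix.of_apply, Matrix.submatrix_apply, e, f]
    rw [mergeFin_cons_insert]
  rw [hsub]
  exact l2_opNorm_submatrix_le _ he hf

/-- Flattenings of `colFlatten h` are flattenings of `h` with the first index among the rows. -/
lemma norm_flatten_colFlatten_le [Nonempty T] (h : (Fin (k + 1) → T) → Matrix S R ℂ)
    (X : Finset (Fin k)) :
    ‖flatten (colFlatten h) X‖ ≤ ‖flatten h (X.map (Fin.succEmb k))‖ := by
  obtain ⟨a⟩ := ‹Nonempty T›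
  set X' := X.map (Fin.succEmb k) with hX'
  let e : ((Xᶜ : Finset (Fin k)) → T) × (T × S) → ((X'ᶜ : Finset (Fin (k + 1))) → T) × S := fun y =>
    (fun j => (Fin.cons y.2.1 (mergeFin X (fun _ => a) y.1) : Fin (k + 1) → T) j, y.2.2)
  let f : (X → T) × R → (X' → T) × R := fun x =>
    (fun j => (Fin.cons a (mergeFin X x.1 fun _ => a) : Fin (k + 1) → T) j, x.2)
  have he : e.Injective := by
    rintro ⟨y, t, s⟩ ⟨y', t', s'⟩ h
    simp only [e, Prod.mk.injEq] at h
    have h0 := congrFun h.1 ⟨0, by simp [hX']⟩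
    refine Prod.ext (funext fun j => ?_) (Prod.ext (by simpa using h0) h.2)
    have hj := Finset.mem_compl.1 j.2
    have := congrFun h.1 ⟨j.1.succ, by simp [hX', hj]⟩
    simpa [mergeFin, hj] using this
  have hf : f.Injective := by
    rintro ⟨x, r⟩ ⟨x', r'⟩ h
    simp only [f, Prod.mk.injEq] at h
    refine Prod.ext (funext fun j => ?_) h.2
    have := congrFun h.1 ⟨j.1.succ, by simp [hX']⟩
    simpa [mergeFin] using this
  have hsub : flatten (colFlatten h) X = (flatten h X').submatrix e f := by
    ext y x
    simp only [flatten, colFlatten, Matrix.of_apply, Matrix.submatrix_apply, e, f]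
    rw [mergeFin_cons_map]
  rw [hsub]
  exact l2_opNorm_submatrix_le _ he hf

end Flatten

universe u v w

/-- The moment bound for a Gaussian chaos with matrix coefficients, in terms of the operator norms of
all the flattenings of its coefficient tensor. The factor `card T ^ k` in the dimension condition
leaves room for the `k` random indices that are moved to the rows or columns. -/
theorem exists_lintegral_wickSum_le (k : ℕ) : ∃ c : ℝ≥0, ∀ {T : Type u} {R : Type (max u v)}
    {S : Type (max u w)} [Fintype T]
    [DecidableEq T] [Nonempty T] [Fintype R] [DecidableEq R] [Fintype S] [DecidableEq S]
    (ι : Fin k → ℤˣ) (h : (Fin k → T) → Matrix S R ℂ) {m : ℕ} {p : ℝ} {K : ℝ≥0∞}, 1 ≤ p →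
    p ≤ 2 ^ m → ((Fintype.card S + Fintype.card R) * Fintype.card T ^ k : ℝ) ≤ Real.exp (2 ^ m) →
    (∀ X : Finset (Fin k), ‖flatten h X‖ₑ ≤ K) →
    ∫⁻ z, ‖wickSum ι h z‖ₑ ^ p ∂gaussianVec T
      ≤ (c * ENNReal.ofReal √(4 * Real.exp 1 * 2 ^ m) ^ k * K) ^ p := by
  induction k with
  | zero =>
    refine ⟨1, ?_⟩
    intro T R S _ _ _ _ _ _ _ ι h m p K hp _ _ hK
    have h1 : ∀ z : T → ℂ, wickSum ι h z = h default := by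
      intro z
      simp [wickSum, wick, signCount, cHermite]
    have h2 : ‖h default‖ₑ ≤ K := by
      refine le_trans ?_ (hK ∅)
      have hsub : h default = (flatten h ∅).submatrix (fun s => (fun j => j.1.elim0, s))
          (fun r => (fun j => j.1.elim0, r)) := by
        ext s r
        simp only [flatten, Matrix.of_apply, Matrix.submatrix_apply]
        congr
      rw [← ofReal_norm, ← ofReal_norm, hsub]
      exact ENNReal.ofReal_le_ofReal (l2_opNorm_submatrix_le _ (fun _ _ h => (Prod.mk.inj h).2)
        (fun _ _ h => (Prod.mk.inj h).2))
    simp only [h1, lintegral_const, measure_univ, mul_one, pow_zero, ENNReal.coe_one, one_mul]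
    exact ENNReal.rpow_le_rpow h2 (by linarith)
  | succ k ih =>
    obtain ⟨c, hc⟩ := ih
    refine ⟨2 ^ (k + 2) * c, ?_⟩
    intro T R S _ _ _ _ _ _ _ ι h m p K hp hpm hD hK
    have hp0 : 0 ≤ p := by linarith
    set Q := ENNReal.ofReal √(4 * Real.exp 1 * 2 ^ m)
    have hT : (1 : ℝ) ≤ Fintype.card T := by exact_mod_cast Fintype.card_pos
    have hTk : (1 : ℝ) ≤ (Fintype.card T : ℝ) ^ (k + 1) := one_le_pow₀ hT
    have hS0 : (0 : ℝ) ≤ Fintype.card S := Nat.cast_nonneg _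
    have hR0 : (0 : ℝ) ≤ Fintype.card R := Nat.cast_nonneg _
    have hTk0 : (0 : ℝ) ≤ (Fintype.card T : ℝ) ^ k := by positivity
    have hKrow : ∀ X : Finset (Fin k), ‖flatten (rowFlatten h) X‖ₑ ≤ K := fun X => by
      refine le_trans ?_ (hK (insert 0 (X.map (Fin.succEmb k))))
      rw [← ofReal_norm, ← ofReal_norm]
      exact ENNReal.ofReal_le_ofReal (norm_flatten_rowFlatten_le h X)
    have hKcol : ∀ X : Finset (Fin k), ‖flatten (colFlatten h) X‖ₑ ≤ K := fun X => by
      refine le_trans ?_ (hK (X.map (Fin.succEmb k)))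
      rw [← ofReal_norm, ← ofReal_norm]
      exact ENNReal.ofReal_le_ofReal (norm_flatten_colFlatten_le h X)
    have hrow := hc (fun j => ι j.succ) (rowFlatten h) (m := m) (p := p) (K := K) hp hpm
      (by
        refine le_trans ?_ hD
        rw [Fintype.card_prod, pow_succ']
        push_cast
        nlinarith [mul_nonneg hS0 hTk0])
      hKrow
    have hcol := hc (fun j => ι j.succ) (colFlatten h) (m := m) (p := p) (K := K) hp hpm
      (by
        refine le_trans ?_ hD
        rw [Fintype.card_prod, pow_succ']
        push_cast
        nlinarith [mul_nonneg hR0 hTk0])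
      hKcol
    have hstep := lintegral_wickSum_succ_le ι h hp hpm (by nlinarith)
    refine hstep.trans ((mul_le_mul_right (add_le_add hrow hcol) _).trans ?_)
    have h2p : (2 : ℝ≥0∞) ≤ 2 ^ p := by
      simpa using ENNReal.rpow_le_rpow_of_exponent_le (x := 2) (by norm_num) hp
    rw [← two_mul]
    calc _ ≤ (2 ^ (k + 1) * Q) ^ p * (2 ^ p * (c * Q ^ k * K) ^ p) :=
          mul_le_mul_right (mul_le_mul_left h2p _) _
      _ = ((2 ^ (k + 1) * Q) * (2 * (c * Q ^ k * K))) ^ p := by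
          rw [← ENNReal.mul_rpow_of_nonneg 2 _ hp0, ← ENNReal.mul_rpow_of_nonneg _ _ hp0]
      _ = _ := by
          congr 1
          push_cast
          ring

end

/-! ### Tensor norms, constants and lattice balls -/

section

open scoped ComplexConjugate Matrix.Norms.L2Operator

section TensorNorm

variable {d : ℕ} {I R S : Type*} [Fintype R] [DecidableEq R] [Fintype S]

lemma sum_enorm_sq {α : Type*} [Fintype α] (v : α → ℂ) :
    ∑ i, ‖v i‖ₑ ^ 2 = ENNReal.ofReal (∑ i, ‖v i‖ ^ 2) := by
  rw [ENNReal.ofReal_sum_of_nonneg fun i _ => by positivity]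
  refine Finset.sum_congr rfl fun i _ => ?_
  rw [ENNReal.ofReal_pow (norm_nonneg _), ofReal_norm]

/-- A finite matrix of entries of a tensor has operator norm at most the tensor norm. -/
lemma enorm_le_tensorNorm (F : LatticeTensor d I) (X : Set I) (M : Matrix S R ℂ)
    {e : R → X → Fin d → ℤ} {f : S → (Xᶜ : Set I) → Fin d → ℤ} (he : e.Injective)
    (hf : f.Injective) (hM : ∀ s r, M s r = F (mergeIndex X (e r) (f s))) :
    ‖M‖ₑ ≤ tensorNorm F X := by
  rcases eq_or_ne (tensorNorm F X) ⊤ with htop | htop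
  · simp [htop]
  rw [← ofReal_norm]
  refine (ENNReal.ofReal_le_iff_le_toReal htop).2 ?_
  rw [Matrix.l2_opNorm_def]
  refine ContinuousLinearMap.opNorm_le_of_unit_norm ENNReal.toReal_nonneg fun v hv => ?_
  refine (ENNReal.ofReal_le_iff_le_toReal htop).1 ?_
  set w : (X → Fin d → ℤ) → ℂ := Function.extend e v 0 with hw
  have hwe : ∀ r, w (e r) = v r := fun r => he.extend_apply _ _ _
  have hw0 : ∀ x, x ∉ Set.range e → w x = 0 := fun x hx => Function.extend_apply' _ _ _ hx
  have h1 : ∑' x, ‖w x‖ₑ ^ 2 ≤ 1 := by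
    rw [← he.tsum_eq (f := fun x => ‖w x‖ₑ ^ 2), tsum_fintype]
    · simp only [hwe]
      rw [sum_enorm_sq, ← EuclideanSpace.norm_sq_eq, hv]
      simp
    · intro x hx
      by_contra h
      exact hx (by simp [hw0 x h])
  have h3 : ∀ y, ∑' x, F (mergeIndex X x y) * w x = ∑ r, F (mergeIndex X (e r) y) * v r := by
    intro y
    rw [← he.tsum_eq (f := fun x => F (mergeIndex X x y) * w x), tsum_fintype]
    · simp only [hwe]
    · intro x hx
      by_contra h
      exact hx (by simp [hw0 x h])
  have h4 : ENNReal.ofReal ‖(Matrix.toEuclideanLin (𝕜 := ℂ)).trans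
      LinearMap.toContinuousLinearMap M v‖ ^ 2 = ∑ s, ‖M.mulVec v s‖ₑ ^ 2 := by
    rw [← ENNReal.ofReal_pow (norm_nonneg _), EuclideanSpace.norm_sq_eq, sum_enorm_sq]
    rfl
  have h5 : ∀ x : ℝ≥0∞, x = (x ^ 2) ^ (1 / 2 : ℝ) := fun x => by
    rw [← ENNReal.rpow_natCast, ← ENNReal.rpow_mul]
    norm_num
  rw [h5 (ENNReal.ofReal _), h4, tensorNorm]
  refine ENNReal.rpow_le_rpow (le_iSup₂_of_le w h1 ?_) (by norm_num)
  simp only [h3]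
  rw [← tsum_fintype (L := .unconditional _) (f := fun s => ‖M.mulVec v s‖ₑ ^ 2)]
  refine le_trans (le_of_eq ?_) (ENNReal.tsum_comp_le_tsum_of_injective hf _)
  simp only [Matrix.mulVec, dotProduct, hM]

/-- If a finite matrix contains all nonzero entries of a tensor, then the tensor norm is at most the
operator norm of the matrix. -/
lemma tensorNorm_le_enorm (F : LatticeTensor d I) (X : Set I) (M : Matrix S R ℂ)
    {e : R → X → Fin d → ℤ} {f : S → (Xᶜ : Set I) → Fin d → ℤ} (he : e.Injective)
    (hf : f.Injective) (hM : ∀ s r, M s r = F (mergeIndex X (e r) (f s)))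
    (hF : ∀ x y, F (mergeIndex X x y) ≠ 0 → x ∈ Set.range e ∧ y ∈ Set.range f) :
    tensorNorm F X ≤ ‖M‖ₑ := by
  have h2 : ‖M‖ₑ = (‖M‖ₑ ^ 2) ^ (1 / 2 : ℝ) := by
    rw [← ENNReal.rpow_natCast, ← ENNReal.rpow_mul]
    norm_num
  rw [tensorNorm, h2]
  refine ENNReal.rpow_le_rpow (iSup₂_le fun v hv => ?_) (by norm_num)
  have h3 : ∀ y, ∑' x, F (mergeIndex X x y) * v x = ∑ r, F (mergeIndex X (e r) y) * v (e r) := by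
    intro y
    rw [← he.tsum_eq (f := fun x => F (mergeIndex X x y) * v x), tsum_fintype]
    intro x hx
    exact (hF x y (left_ne_zero_of_mul hx)).1
  have h4 : ∑' y, ‖∑' x, F (mergeIndex X x y) * v x‖ₑ ^ 2
      = ∑ s, ‖M.mulVec (fun r => v (e r)) s‖ₑ ^ 2 := by
    simp only [h3]
    rw [← hf.tsum_eq (f := fun y => ‖∑ r, F (mergeIndex X (e r) y) * v (e r)‖ₑ ^ 2), tsum_fintype]
    · simp only [Matrix.mulVec, dotProduct, hM]
    · intro y hy
      by_contra hyf
      refine hy ?_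
      have : ∀ r, F (mergeIndex X (e r) y) = 0 := fun r => by
        by_contra h
        exact hyf (hF _ _ h).2
      simp [this]
  have h5 : ∑ r, ‖v (e r)‖ₑ ^ 2 ≤ 1 := by
    refine le_trans ?_ hv
    rw [← tsum_fintype (L := .unconditional _) (f := fun r => ‖v (e r)‖ₑ ^ 2)]
    exact ENNReal.tsum_comp_le_tsum_of_injective he _
  rw [h4, sum_enorm_sq]
  refine (ENNReal.ofReal_le_ofReal (sum_norm_mulVec_sq_le M _)).trans ?_
  rw [ENNReal.ofReal_mul (by positivity), ← sum_enorm_sq, ENNReal.ofReal_pow (norm_nonneg _),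
    ofReal_norm]
  exact mul_le_of_le_one_right' h5

end TensorNorm

section Constants

/-- The dimension of the matrices is polynomial in `N`. The bound `2 * N + 1 ≤ N ^ 3` uses `2 ≤ N`. -/
lemma log_bound (d e N : ℕ) (hN : 2 ≤ N) {t : ℝ} (ht : 1 ≤ t) (htN : t ≤ (2 * N + 1) ^ d) :
    2 * t ^ e ≤ Real.exp ((1 + 3 * d * e) * Real.log N) := by
  have hN' : (2 : ℝ) ≤ N := by exact_mod_cast hN
  have h1 : (2 * N + 1 : ℝ) ≤ N ^ 3 := by nlinarith [mul_self_nonneg ((N : ℝ) - 2)]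
  have h2 : Real.exp ((1 + 3 * d * e) * Real.log N) = N * ((N : ℝ) ^ 3) ^ (d * e) := by
    rw [mul_comm, ← Real.rpow_def_of_pos (by positivity)]
    have : (1 + 3 * d * e : ℝ) = ((1 + 3 * (d * e) : ℕ) : ℝ) := by push_cast; ring
    rw [this, Real.rpow_natCast, pow_add, pow_one, pow_mul]
  rw [h2]
  have h3 : t ^ e ≤ ((N : ℝ) ^ 3) ^ (d * e) := by
    rw [pow_mul]
    exact pow_le_pow_left₀ (by linarith)
      (htN.trans (pow_le_pow_left₀ (by positivity) h1 d)) e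
  exact mul_le_mul hN' h3 (by positivity) (by positivity)

/-- The choice of the power of two `2 ^ m ≥ max p (log D)` of size `O(p log N)`. -/
lemma exists_pow_two_near {N : ℕ} (hN : 2 ≤ N) {p E : ℝ} (hp : 1 ≤ p) (hE : 0 ≤ E) :
    ∃ m : ℕ, p ≤ 2 ^ m ∧ E * Real.log N ≤ 2 ^ m ∧
      (2 : ℝ) ^ m ≤ 2 * (E + 2) * (p * Real.log N) := by
  have hl : 1 / 2 ≤ Real.log N := by
    have h1 : Real.log 2 ≤ Real.log N := Real.log_le_log (by norm_num) (by exact_mod_cast hN)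
    linarith [Real.log_two_gt_d9]
  have hpl : p ≤ 2 * (p * Real.log N) := by nlinarith
  have hEl : E * Real.log N ≤ E * (p * Real.log N) :=
    mul_le_mul_of_nonneg_left (le_mul_of_one_le_left (by linarith) hp) hE
  have hEp : 0 ≤ E * (p * Real.log N) := by positivity
  obtain ⟨n, hn1, hn2⟩ := exists_nat_pow_near (x := (E + 2) * (p * Real.log N)) (y := (2 : ℝ))
    (by nlinarith) (by norm_num)
  refine ⟨n + 1, by nlinarith, by nlinarith, ?_⟩
  rw [pow_succ]
  linarith

end Constants

section LatticeBall

variable {d : ℕ}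

/-- The lattice points of `ℓ¹` norm at most `N`. -/
noncomputable def latticeBall (d N : ℕ) : Finset (Fin d → ℤ) :=
  (Fintype.piFinset fun _ => Finset.Icc (-(N : ℤ)) N).filter fun n => ∑ l, |n l| ≤ (N : ℤ)

lemma mem_latticeBall {N : ℕ} {n : Fin d → ℤ} : n ∈ latticeBall d N ↔ ∑ l, |n l| ≤ (N : ℤ) := by
  simp only [latticeBall, Finset.mem_filter, Fintype.mem_piFinset, Finset.mem_Icc,
    and_iff_right_iff_imp, ← abs_le]
  exact fun h l => (Finset.single_le_sum (f := fun l => |n l|) (fun _ _ => abs_nonneg _)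
    (Finset.mem_univ l)).trans h

instance (N : ℕ) : Nonempty (latticeBall d N) := ⟨⟨0, mem_latticeBall.2 (by simp)⟩⟩

lemma card_latticeBall_le (N : ℕ) : (latticeBall d N).card ≤ (2 * N + 1) ^ d := by
  refine (Finset.card_filter_le _ _).trans (le_of_eq ?_)
  rw [Fintype.card_piFinset]
  simp
  congr 1
  omega

end LatticeBall

end

/-! ### The random tensor estimate -/

section

open scoped ComplexConjugate Matrix.Norms.L2Operator

section Assembly

variable {k d : ℕ} {A B : Type*}

/-- The restriction of the tensor `h` to lattice points of norm at most `N`, as a family of matrices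
with columns `n_A` and rows `n_B`. -/
noncomputable def tensorMatrix (N : ℕ) (h : LatticeTensor d (Fin k ⊕ (A ⊕ B)))
    (n : Fin k → latticeBall d N) : Matrix (B → latticeBall d N) (A → latticeBall d N) ℂ :=
  Matrix.of fun y x => h (Sum.elim (fun j => (n j : Fin d → ℤ))
    (Sum.elim (fun i => (x i : Fin d → ℤ)) fun i => (y i : Fin d → ℤ)))

/-- All indices of a tensor supported on the lattice ball can be taken in the ball. -/
lemma randomTensor_eq_wickSum {N : ℕ} {h : LatticeTensor d (Fin k ⊕ (A ⊕ B))}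
    (hh : ∀ n, h n ≠ 0 → ∀ i, n i ∈ latticeBall d N) (ι : Fin k → ℤˣ) (g : (Fin d → ℤ) → ℂ)
    (x : A → latticeBall d N) (y : B → latticeBall d N) :
    randomTensor h ι g (Sum.elim (fun i => (x i : Fin d → ℤ)) fun i => (y i : Fin d → ℤ))
      = wickSum ι (tensorMatrix N h) (fun t => g t) y x := by
  have hinj : Function.Injective fun (n : Fin k → latticeBall d N) (j : Fin k) =>
      (n j : Fin d → ℤ) := fun n n' h => funext fun j => Subtype.ext (congrFun h j)
  rw [randomTensor, ← hinj.tsum_eq, tsum_fintype]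
  · simp only [wickSum, Matrix.sum_apply, Matrix.smul_apply, smul_eq_mul, tensorMatrix,
      Matrix.of_apply]
    refine Finset.sum_congr rfl fun n _ => ?_
    rw [renormProd_eq_wick, mul_comm]
  · intro n hn
    have hn' := hh _ (left_ne_zero_of_mul hn)
    exact ⟨fun j => ⟨n j, hn' (Sum.inl j)⟩, rfl⟩

/-- The norm of the random tensor is bounded by that of the corresponding matrix. -/
lemma tensorNorm_randomTensor_le [Fintype A] [DecidableEq A] [Fintype B]
    [DecidableEq B] {N : ℕ}
    {h : LatticeTensor d (Fin k ⊕ (A ⊕ B))} (hh : ∀ n, h n ≠ 0 → ∀ i, n i ∈ latticeBall d N)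
    (ι : Fin k → ℤˣ) (g : (Fin d → ℤ) → ℂ) :
    tensorNorm (randomTensor h ι g) (Set.range Sum.inl)
      ≤ ‖wickSum ι (tensorMatrix N h) (fun t => g t)‖ₑ := by
  classical
  have hmem : ∀ i : ((Set.range (Sum.inl : A → A ⊕ B))ᶜ : Set (A ⊕ B)), ∃ b, i.1 = Sum.inr b := by
    rintro ⟨a | b, hi⟩
    · exact absurd ⟨a, rfl⟩ hi
    · exact ⟨b, rfl⟩
  refine tensorNorm_le_enorm _ _ _
    (e := fun x i => Sum.elim (fun a => (x a : Fin d → ℤ)) (fun _ => 0) i.1)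
    (f := fun y i => Sum.elim (fun _ => 0) (fun b => (y b : Fin d → ℤ)) i.1) ?_ ?_ ?_ ?_
  · intro x x' hx
    funext a
    exact Subtype.ext (congrFun hx ⟨Sum.inl a, a, rfl⟩)
  · intro y y' hy
    funext b
    exact Subtype.ext (congrFun hy ⟨Sum.inr b, by simp⟩)
  · intro y x
    rw [← randomTensor_eq_wickSum hh]
    congr 1
    funext i
    rcases i with a | b <;> simp [mergeIndex]
  · intro x y hxy
    have hball : ∀ i, mergeIndex (Set.range Sum.inl) x y i ∈ latticeBall d N := by
      intro i
      by_contra hi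
      refine hxy ?_
      rw [randomTensor]
      have h0 : ∀ n : Fin k → Fin d → ℤ, h (Sum.elim n (mergeIndex (Set.range Sum.inl) x y)) = 0 := by
        intro n
        by_contra hn
        exact hi (hh _ hn (Sum.inr i))
      simp [h0]
    constructor
    · refine ⟨fun a => ⟨x ⟨Sum.inl a, a, rfl⟩, ?_⟩, ?_⟩
      · simpa [mergeIndex] using hball (Sum.inl a)
      · funext ⟨i, a, ha⟩
        subst ha
        rfl
    · refine ⟨fun b => ⟨y ⟨Sum.inr b, by simp⟩, ?_⟩, ?_⟩
      · simpa [mergeIndex] using hball (Sum.inr b)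
      · funext i
        obtain ⟨i, hi⟩ := i
        obtain ⟨b, rfl⟩ := hmem ⟨i, hi⟩
        rfl

/-- Flattenings of the coefficient matrices are submatrices of flattenings of `h`. -/
lemma enorm_flatten_tensorMatrix_le [Fintype A] [DecidableEq A] [Fintype B]
    [DecidableEq B] (N : ℕ)
    (h : LatticeTensor d (Fin k ⊕ (A ⊕ B))) (X : Finset (Fin k)) :
    ‖flatten (tensorMatrix N h) X‖ₑ
      ≤ tensorNorm h (Sum.inl '' (X : Set (Fin k)) ∪ Set.range fun i : A => Sum.inr (Sum.inl i)) := by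
  classical
  -- `t₀` and `0` fill coordinates that are not read
  have t₀ : latticeBall d N := Classical.arbitrary _
  refine enorm_le_tensorNorm _ _ _
    (e := fun x i => Sum.elim (fun j => ((mergeFin X x.1 (fun _ => t₀) j : latticeBall d N) :
      Fin d → ℤ)) (Sum.elim (fun a => (x.2 a : Fin d → ℤ)) fun _ => 0) i.1)
    (f := fun y i => Sum.elim (fun j => ((mergeFin X (fun _ => t₀) y.1 j : latticeBall d N) :
      Fin d → ℤ)) (Sum.elim (fun _ => 0) fun b => (y.2 b : Fin d → ℤ)) i.1) ?_ ?_ ?_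
  · intro x x' hx
    refine Prod.ext (funext fun j => ?_) (funext fun a => ?_)
    · have := congrFun hx ⟨Sum.inl j.1, by simp⟩
      simpa [mergeFin] using this
    · exact Subtype.ext (congrFun hx ⟨Sum.inr (Sum.inl a), by simp⟩)
  · intro y y' hy
    refine Prod.ext (funext fun j => ?_) (funext fun b => ?_)
    · have hj := Finset.mem_compl.1 j.2
      have := congrFun hy ⟨Sum.inl j.1, by simp [hj]⟩
      simpa [mergeFin, hj] using this
    · exact Subtype.ext (congrFun hy ⟨Sum.inr (Sum.inr b), by simp⟩)
  · intro y x
    simp only [flatten, tensorMatrix, Matrix.of_apply]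
    congr 1
    funext i
    rcases i with j | a | b
    · by_cases hj : j ∈ X <;> simp [mergeIndex, mergeFin, hj]
    · simp [mergeIndex]
    · simp [mergeIndex]

end Assembly

end

section

open scoped ComplexConjugate Matrix.Norms.L2Operator

theorem theorem1p3 (k d a b : ℕ) :
    ∃ C : ℝ, 0 < C ∧
      ∀ {A B : Type*} [Fintype A] [Fintype B], Fintype.card A = a → Fintype.card B = b →
      ∀ (N : ℕ), 2 ≤ N →
      ∀ (h : LatticeTensor d (Fin k ⊕ (A ⊕ B))),
        (∀ n, h n ≠ 0 → ∀ i, ∑ l, |n i l| ≤ (N : ℤ)) →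
      ∀ (ι : Fin k → ℤˣ)
        {Ω : Type*} [MeasurableSpace Ω] (P : Measure Ω) [IsProbabilityMeasure P]
        (g : (Fin d → ℤ) → Ω → ℂ),
        (∀ n, HasLaw (g n) stdComplexGaussian P) → iIndepFun g P →
      ∀ (p : ℝ), 1 ≤ p →
        (∫⁻ ω, tensorNorm (randomTensor h ι (fun n => g n ω)) (Set.range Sum.inl) ^ p ∂P) ^ (1 / p)
          ≤ ENNReal.ofReal (C * p ^ ((k : ℝ) / 2) * Real.log N ^ ((k : ℝ) / 2)) *
            ⨆ X : Set (Fin k),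
              tensorNorm h (Sum.inl '' X ∪ Set.range (fun i : A => Sum.inr (Sum.inl i))) := by
  obtain ⟨c, hc⟩ := exists_lintegral_wickSum_le k
  set E : ℝ := 1 + 3 * d * (a + b + k : ℕ) with hE
  set F : ℝ := 4 * Real.exp 1 * (2 * (E + 2)) with hF
  have hE0 : 0 ≤ E := by positivity
  have hF0 : 0 < F := by positivity
  refine ⟨(c + 1) * F ^ ((k : ℝ) / 2), by positivity, ?_⟩
  intro A B _ _ hA hB N hN h hh ι Ω _ P _ g hg hind p hp
  classical
  have hp0 : 0 < p := by linarith
  -- the moment exponent `2 ^ m` exceeds both `p` and the logarithm of the dimension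
  obtain ⟨m, hm1, hm2, hm3⟩ := exists_pow_two_near hN hp hE0
  have hlog : 0 < Real.log N := Real.log_pos (by exact_mod_cast hN)
  have hball : ∀ n, h n ≠ 0 → ∀ i, n i ∈ latticeBall d N := fun n hn i =>
    mem_latticeBall.2 (hh n hn i)
  set K : ℝ≥0∞ := ⨆ X : Set (Fin k),
    tensorNorm h (Sum.inl '' X ∪ Set.range (fun i : A => Sum.inr (Sum.inl i))) with hK
  have hcard : ((Fintype.card (B → latticeBall d N) + Fintype.card (A → latticeBall d N)) *
      Fintype.card (latticeBall d N) ^ k : ℝ) ≤ Real.exp (2 ^ m) := by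
    set t : ℝ := (Fintype.card (latticeBall d N) : ℝ) with ht
    have ht1 : 1 ≤ t := by
      rw [ht]
      exact_mod_cast Fintype.card_pos
    have htN : t ≤ (2 * N + 1) ^ d := by
      rw [ht, Fintype.card_coe]
      exact_mod_cast card_latticeBall_le N
    refine le_trans ?_ ((log_bound d (a + b + k) N hN ht1 htN).trans
      (Real.exp_le_exp.2 hm2))
    rw [Fintype.card_fun, Fintype.card_fun, hA, hB]
    push_cast
    rw [← ht, pow_add, pow_add]
    have h1 : 1 ≤ t ^ a := one_le_pow₀ ht1
    have h2 : 1 ≤ t ^ b := one_le_pow₀ ht1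
    have h3 : t ^ b + t ^ a ≤ 2 * (t ^ a * t ^ b) := by nlinarith
    calc (t ^ b + t ^ a) * t ^ k ≤ (2 * (t ^ a * t ^ b)) * t ^ k :=
          mul_le_mul_of_nonneg_right h3 (by positivity)
      _ = _ := by ring
  have hmain := hc ι (tensorMatrix N h) (K := K) hp hm1 hcard fun X =>
    (enorm_flatten_tensorMatrix_le N h X).trans (le_iSup (fun X : Set (Fin k) =>
      tensorNorm h (Sum.inl '' X ∪ Set.range (fun i : A => Sum.inr (Sum.inl i)))) (X : Set (Fin k)))
  have hlaw : HasLaw (fun ω (t : latticeBall d N) => g t ω) (gaussianVec (latticeBall d N)) P :=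
    (hind.precomp Subtype.val_injective).hasLaw_pi fun t => hg t
  have hint : ∫⁻ ω, tensorNorm (randomTensor h ι (fun n => g n ω)) (Set.range Sum.inl) ^ p ∂P
      ≤ ∫⁻ z, ‖wickSum ι (tensorMatrix N h) z‖ₑ ^ p ∂gaussianVec (latticeBall d N) := by
    rw [← hlaw.map_eq, lintegral_map' _ hlaw.aemeasurable]
    · exact lintegral_mono fun ω =>
        ENNReal.rpow_le_rpow (tensorNorm_randomTensor_le hball ι _) hp0.le
    · exact ((continuous_wickSum ι (tensorMatrix N h)).enorm.measurable.pow_const p).aemeasurable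
  have hfin := ENNReal.rpow_le_rpow (hint.trans hmain) (one_div_nonneg.2 hp0.le)
  rw [← ENNReal.rpow_mul, mul_one_div_cancel hp0.ne', ENNReal.rpow_one] at hfin
  refine hfin.trans (mul_le_mul_left ?_ K)
  have hQ : √(4 * Real.exp 1 * 2 ^ m) ^ k ≤ F ^ ((k : ℝ) / 2) * p ^ ((k : ℝ) / 2)
      * Real.log N ^ ((k : ℝ) / 2) := by
    rw [← Real.mul_rpow hF0.le hp0.le, ← Real.mul_rpow (by positivity) hlog.le,
      Real.sqrt_eq_rpow, ← Real.rpow_natCast, ← Real.rpow_mul (by positivity)]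
    have : (1 / 2 : ℝ) * k = k / 2 := by ring
    rw [this]
    refine Real.rpow_le_rpow (by positivity) ?_ (by positivity)
    calc 4 * Real.exp 1 * 2 ^ m ≤ 4 * Real.exp 1 * (2 * (E + 2) * (p * Real.log N)) :=
          mul_le_mul_of_nonneg_left hm3 (by positivity)
      _ = _ := by rw [hF]; ring
  rw [← ENNReal.ofReal_pow (Real.sqrt_nonneg _), ← ENNReal.ofReal_coe_nnreal,
    ← ENNReal.ofReal_mul (by positivity)]
  refine ENNReal.ofReal_le_ofReal ?_
  calc (c : ℝ) * √(4 * Real.exp 1 * 2 ^ m) ^ k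
      ≤ (c + 1) * (F ^ ((k : ℝ) / 2) * p ^ ((k : ℝ) / 2) * Real.log N ^ ((k : ℝ) / 2)) :=
        mul_le_mul (by linarith) hQ (by positivity) (by positivity)
    _ = _ := by ring

end
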